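/- Consider a timely asynchronous hierarchical federated learning (AHFL) system with $n=e\ell$ clients, divided into $e$ clusters of $\ell$ clients each; every cluster has an edge server, and all edge servers communicate with one cloud server. Fix constants $\alpha,\beta\in(0,1)$ and let $m=\beta\ell$ and $k=\alpha m=\alpha\beta\ell$ (rounded up, $m=\lceil\beta\ell\rceil$ and $k=\lceil\alpha m\rceil$, when these are not integers). Every edge server, starting at time $0$, runs training cycles one after the other. In each cycle every client of the cluster becomes available after an exponential time with parameter $\lambda>0$ counted from the start of the cycle; as soon as $m$ clients are available, these $m$ clients receive the model, train for a deterministic time $c\ge 0$, and then each of them sends its model to the edge server in an exponential time with parameter $\tilde\mu>0$; the cycle ends when the first $k$ of the $m$ clients have responded. All these exponential times (over clusters, cycles and clients) are independent. At the end of each cycle of each edge server the version number of the cloud, initially $0$, increases by one, and the version number of each of the $k$ aggregated clients is set to the new version number of the cloud; the version numbers of the other clients do not change, and all of them are initially $0$. For $j=1,2,\dots$ let $T^i_j$ be the time of the $j$-th successful participation of client $i$ (the end of the $j$-th cycle in which it is among the $k$ aggregated clients), and let the staleness $S_i[j]$ be the difference between the version numbers of the cloud and of client $i$ immediately before $T^i_j$.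 Suppose that the number of clusters is $e=O(1)$, i.e. $e\le e_{\max}$ for a constant $e_{\max}$. Then for every $0<\varepsilon<1$ there is a constant $M$, depending only on $\alpha,\beta,\varepsilon,e_{\max}$ and in particular not on $n$, such that $$\mathbb{P}\big(S_i[j]\le M\big)\ \ge\ 1-\varepsilon$$ for every such system, every client $i$ and every $j\ge 1$. Moreover, in steady state every $M\ge\frac1\varepsilon\left(\frac{e}{\alpha\beta}-1\right)$ suffices: for every such system, every such $M$ and every client $i$, $\mathbb{P}(S_i[j]\le M)\ge 1-\varepsilon$ for all sufficiently large $j$. -/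

import Mathlib

open MeasureTheory ProbabilityTheory Filter

/-! A timely asynchronous hierarchical federated learning (AHFL) system: `e` edge servers, each with
its own cluster of `ℓ` clients, and one cloud server. In every training cycle of an edge server, the
server waits for the first `m` of its `ℓ` clients to become available, sends them the current model,
each of them trains for `c` units of time and then needs a random uplink time, and the cycle ends when
the first `k` of these `m` clients have responded. The aggregated model is sent at once to the cloud,
whose version number increases by one; the `k` clients that were aggregated get the new version, and
the next cycle of that edge server starts immediately. -/

namespace AHFL

noncomputable section

/-- Number of elements of `s` that come before `i` when `s` is ordered by the times `x`
(ties are broken by the label; for the continuous laws used below they have probability zero). -/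
def rank {ℓ : ℕ} (s : Finset (Fin ℓ)) (x : Fin ℓ → ℝ) (i : Fin ℓ) : ℕ :=
  (s.filter fun j => x j < x i ∨ (x j = x i ∧ j < i)).card

/-- The `q` earliest elements of `s` with respect to the times `x`. -/
def earliest {ℓ : ℕ} (q : ℕ) (s : Finset (Fin ℓ)) (x : Fin ℓ → ℝ) : Finset (Fin ℓ) :=
  s.filter fun i => rank s x i < q

/-- The time at which the last element of `s` is reached (`0` for the empty set). -/
def lastTime {ℓ : ℕ} (s : Finset (Fin ℓ)) (x : Fin ℓ → ℝ) : ℝ :=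
  if h : s.Nonempty then s.sup' h x else 0

/-- The clients that receive the model in a cycle: the first `m` available ones.
Here `a i` is the availability time of client `i` in this cycle. -/
def available {ℓ : ℕ} (m : ℕ) (a : Fin ℓ → ℝ) : Finset (Fin ℓ) :=
  earliest m Finset.univ a

/-- The clients whose models are aggregated in a cycle: the first `k` responders among the available
ones. All of them train for the same time `c`, so that the order is that of the uplink times `u`. -/
def aggregated {ℓ : ℕ} (m k : ℕ) (a u : Fin ℓ → ℝ) : Finset (Fin ℓ) :=
  earliest k (available m a) u

/-- Duration of a training cycle: time until `m` clients are available, plus training time, plus time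
until `k` of them have responded. -/
def cycleDuration {ℓ : ℕ} (m k : ℕ) (c : ℝ) (a u : Fin ℓ → ℝ) : ℝ :=
  lastTime (available m a) a + c + lastTime (aggregated m k a u) u

/-! From here on, `a s r i` and `u s r i` are the availability time and the uplink time of client `i`
of cluster `s` in the training cycle number `r` (`r = 0, 1, 2, …`) of edge server `s`. -/

/-- The time at which edge server `s` completes its cycle number `r`; all servers start at time `0`. -/
def completionTime {e ℓ : ℕ} (m k : ℕ) (c : ℝ) (a u : Fin e → ℕ → Fin ℓ → ℝ)
    (s : Fin e) (r : ℕ) : ℝ :=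
  ∑ q ∈ Finset.range (r + 1), cycleDuration m k c (a s q) (u s q)

/-- Cloud version at time `τ`: the number of edge updates received by the cloud up to time `τ`. -/
def cloudVersion {e ℓ : ℕ} (m k : ℕ) (c : ℝ) (a u : Fin e → ℕ → Fin ℓ → ℝ) (τ : ℝ) : ℕ :=
  {x : Fin e × ℕ | completionTime m k c a u x.1 x.2 ≤ τ}.ncard

/-- The time `Tⁱⱼ` of the `j`-th successful participation (`j = 1, 2, …`) of client `i` of cluster `s`,
that is, the end of the `j`-th cycle in which its model is aggregated; `Tⁱ₀ = 0`. -/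
def updateTime {e ℓ : ℕ} (m k : ℕ) (c : ℝ) (a u : Fin e → ℕ → Fin ℓ → ℝ)
    (s : Fin e) (i : Fin ℓ) : ℕ → ℝ
  | 0 => 0
  | j + 1 => completionTime m k c a u s
      (Nat.nth (fun r => i ∈ aggregated m k (a s r) (u s r)) j)

/-- Number of successful participations of the client up to time `τ`. -/
def updateCount {e ℓ : ℕ} (m k : ℕ) (c : ℝ) (a u : Fin e → ℕ → Fin ℓ → ℝ)
    (s : Fin e) (i : Fin ℓ) (τ : ℝ) : ℕ :=
  {j : ℕ | 1 ≤ j ∧ updateTime m k c a u s i j ≤ τ}.ncard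

/-- Version of the client at time `τ`: the cloud version at its last successful participation
up to time `τ`. -/
def clientVersion {e ℓ : ℕ} (m k : ℕ) (c : ℝ) (a u : Fin e → ℕ → Fin ℓ → ℝ)
    (s : Fin e) (i : Fin ℓ) (τ : ℝ) : ℕ :=
  cloudVersion m k c a u (updateTime m k c a u s i (updateCount m k c a u s i τ))

/-- Version difference between the cloud and the client at time `τ`. -/
def versionGap {e ℓ : ℕ} (m k : ℕ) (c : ℝ) (a u : Fin e → ℕ → Fin ℓ → ℝ)
    (s : Fin e) (i : Fin ℓ) (τ : ℝ) : ℤ :=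
  (cloudVersion m k c a u τ : ℤ) - (clientVersion m k c a u s i τ : ℤ)

/-- Staleness of the `j`-th successful participation (`j = 1, 2, …`): the version difference
immediately before it. -/
def staleness {e ℓ : ℕ} (m k : ℕ) (c : ℝ) (a u : Fin e → ℕ → Fin ℓ → ℝ)
    (s : Fin e) (i : Fin ℓ) (j : ℕ) : ℤ :=
  Function.leftLim (versionGap m k c a u s i) (updateTime m k c a u s i j)

/-- The randomness of the system: the availability times are exponential with parameter `lam`, the
uplink times are exponential with parameter `mu`, and all these times, over all clusters, cycles and
clients, are independent. -/
structure IsTimelyAHFL {Ω : Type*} [MeasurableSpace Ω] (P : Measure Ω) {e ℓ : ℕ} (lam mu : ℝ)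
    (A U : Fin e → ℕ → Fin ℓ → Ω → ℝ) : Prop where
  law_avail : ∀ s r i, HasLaw (A s r i) (expMeasure lam) P
  law_uplink : ∀ s r i, HasLaw (U s r i) (expMeasure mu) P
  indep : iIndepFun
    (Sum.elim (fun x : Fin e × ℕ × Fin ℓ => A x.1 x.2.1 x.2.2)
      (fun x : Fin e × ℕ × Fin ℓ => U x.1 x.2.1 x.2.2)) P

/-- Staleness as a random variable: the staleness of the realized times. -/
def randomStaleness {Ω : Type*} {e ℓ : ℕ} (m k : ℕ) (c : ℝ)
    (A U : Fin e → ℕ → Fin ℓ → Ω → ℝ) (s : Fin e) (i : Fin ℓ) (j : ℕ) (ω : Ω) : ℤ :=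
  staleness m k c (fun s r i => A s r i ω) (fun s r i => U s r i ω) s i j

end

end AHFL

open scoped ENNReal Topology

/-! ### Renewal function: subadditivity and Wald's inequality -/

namespace Renewal

/-- The law of the sum of `n` independent random variables with law `F`. -/
noncomputable def walkLaw (F : Measure ℝ) : ℕ → Measure ℝ
  | 0 => Measure.dirac 0
  | n + 1 => walkLaw F n ∗ F

/-- The renewal function: expected number of `n ≥ 0` with `S_n ≤ t`. -/
noncomputable def renewalFun (F : Measure ℝ) (t : ℝ) : ℝ≥0∞ := ∑' n, walkLaw F n (Set.Iic t)

/-- The mean of a law truncated at level `a`. -/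
noncomputable def truncMean (F : Measure ℝ) (a : ℝ) : ℝ≥0∞ := ∫⁻ x, ENNReal.ofReal (min x a) ∂F

/-- Expected number of renewals of one walk during the step number `g` of an independent copy. -/
noncomputable def crossings (F : Measure ℝ) (g : ℕ) : ℝ≥0∞ :=
  ∫⁻ t, ∫⁻ x, ∑' r, walkLaw F (r + 1) (Set.Ioc t (t + x)) ∂F ∂(walkLaw F g)

lemma walkLaw_zero_preimage (F : Measure ℝ) (y : ℝ) {s : Set ℝ} (hs : MeasurableSet s) :
    walkLaw F 0 ((fun t => y + t) ⁻¹' s) = s.indicator 1 y := by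
  rw [walkLaw, Measure.dirac_apply' _ (measurable_const_add y hs)]
  by_cases h : y ∈ s <;> simp [h]

variable {F : Measure ℝ} [IsProbabilityMeasure F]

instance isProbabilityMeasure_walkLaw (n : ℕ) : IsProbabilityMeasure (walkLaw F n) := by
  induction n with
  | zero => exact Measure.dirac.isProbabilityMeasure
  | succ n ih => rw [walkLaw]; infer_instance

lemma lintegral_walkLaw_succ (n : ℕ) {f : ℝ → ℝ≥0∞} (hf : Measurable f) :
    ∫⁻ z, f z ∂(walkLaw F (n + 1)) = ∫⁻ x, ∫⁻ t, f (x + t) ∂(walkLaw F n) ∂F := by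
  rw [walkLaw, Measure.conv_comm, Measure.lintegral_conv hf]

lemma walkLaw_succ_apply (n : ℕ) {s : Set ℝ} (hs : MeasurableSet s) :
    walkLaw F (n + 1) s = ∫⁻ x, walkLaw F n ((fun t => x + t) ⁻¹' s) ∂F := by
  rw [← lintegral_indicator_one hs, lintegral_walkLaw_succ n (by fun_prop (disch := exact hs))]
  refine lintegral_congr fun x => ?_
  rw [← lintegral_indicator_one (measurable_const_add x hs)]
  rfl

lemma measurable_walkLaw_preimage (n : ℕ) (y : ℝ) {s : Set ℝ} (hs : MeasurableSet s) :
    Measurable fun x => walkLaw F n ((fun t => y + x + t) ⁻¹' s) :=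
  measurable_measure_prodMk_left (ν := walkLaw F n)
    (s := (fun q : ℝ × ℝ => y + q.1 + q.2) ⁻¹' s) (hs.preimage (by fun_prop))

lemma walkLaw_succ_preimage (n : ℕ) (y : ℝ) {s : Set ℝ} (hs : MeasurableSet s) :
    walkLaw F (n + 1) ((fun t => y + t) ⁻¹' s)
      = ∫⁻ x, walkLaw F n ((fun t => y + x + t) ⁻¹' s) ∂F := by
  rw [walkLaw_succ_apply n (measurable_const_add y hs)]
  simp [← Set.preimage_comp, Function.comp_def, add_assoc]

/-- First-entrance argument for a walk started at `y`. While `y ≤ t` the zeroth term vanishes and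
one step is conditioned on. Once `t < y`, being at most `t + x` forces a further displacement of at
most `x`. No sign of the steps is needed. -/
lemma sum_walkLaw_Ioc_le (t x : ℝ) (R : ℕ) (y : ℝ) :
    ∑ n ∈ Finset.range R, walkLaw F n ((fun z => y + z) ⁻¹' Set.Ioc t (t + x))
      ≤ renewalFun F x := by
  induction R generalizing y with
  | zero => simp
  | succ R ih =>
    by_cases hy : t < y
    · refine (Finset.sum_le_sum fun n _ => measure_mono ?_).trans
        (ENNReal.sum_le_tsum (f := fun n => walkLaw F n (Set.Iic x)) _)
      intro z hz
      have := hz.2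
      simp only [Set.mem_Iic]
      linarith
    · rw [Finset.sum_range_succ', walkLaw_zero_preimage F y measurableSet_Ioc,
        Set.indicator_of_notMem (fun h => hy h.1), add_zero,
        Finset.sum_congr rfl fun n _ => walkLaw_succ_preimage n y measurableSet_Ioc,
        ← lintegral_finsetSum _ fun n _ => measurable_walkLaw_preimage n y measurableSet_Ioc]
      calc _ ≤ ∫⁻ _, renewalFun F x ∂F := lintegral_mono fun x' => ih (y + x')
        _ = _ := by simp

/-- The expected number of visits to an interval is at most that of an interval starting at `0`. -/
lemma tsum_walkLaw_succ_Ioc_le (t x : ℝ) :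
    ∑' r, walkLaw F (r + 1) (Set.Ioc t (t + x)) ≤ renewalFun F x := by
  refine (ENNReal.tsum_comp_le_tsum_of_injective (f := fun r : ℕ => r + 1)
    (add_left_injective 1) (fun r => walkLaw F r (Set.Ioc t (t + x)))).trans ?_
  refine ENNReal.tsum_le_of_sum_range_le fun R => ?_
  simpa only [zero_add, Set.preimage_id'] using sum_walkLaw_Ioc_le (F := F) t x R 0

/-- Each visit to `(-∞, t]` pays the mean of the next step cut at `a`. The cut steps add up to at
most `t - y` plus one overshoot of at most `a`, and nonnegative steps never return below `t`. -/
lemma sum_walkLaw_Iic_le (hF : ∀ᵐ x ∂F, 0 ≤ x) {a : ℝ} (ha : 0 ≤ a) (t : ℝ) (R : ℕ) (y : ℝ) :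
    truncMean F a * ∑ n ∈ Finset.range R, walkLaw F n ((fun z => y + z) ⁻¹' Set.Iic t)
      ≤ if y ≤ t then ENNReal.ofReal (t - y + a) else 0 := by
  induction R generalizing y with
  | zero => simp
  | succ R ih =>
    have hm := fun n => measurable_walkLaw_preimage (F := F) n y (measurableSet_Iic (a := t))
    rw [Finset.sum_range_succ', walkLaw_zero_preimage F y measurableSet_Iic,
      Finset.sum_congr rfl fun n _ => walkLaw_succ_preimage n y measurableSet_Iic,
      ← lintegral_finsetSum _ fun n _ => hm n, mul_add,
      ← lintegral_const_mul _ (Finset.measurable_sum _ fun n _ => hm n)]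
    by_cases hy : y ≤ t
    · simp only [hy, if_true, Set.indicator_of_mem (Set.mem_Iic.2 hy), Pi.one_apply, mul_one]
      conv_lhs => enter [2]; rw [truncMean]
      rw [← lintegral_add_right _ (by fun_prop)]
      calc _ ≤ ∫⁻ _, ENNReal.ofReal (t - y + a) ∂F := by
            refine lintegral_mono_ae ?_
            filter_upwards [hF] with x' hx'
            refine (add_le_add_left (ih (y + x')) _).trans ?_
            split_ifs with h
            · rw [← ENNReal.ofReal_add (by linarith) (le_min hx' ha)]
              refine ENNReal.ofReal_le_ofReal ?_
              linarith [min_le_left x' a]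
            · rw [zero_add]
              refine ENNReal.ofReal_le_ofReal ?_
              linarith [min_le_right x' a]
        _ = _ := by simp
    · rw [if_neg hy, Set.indicator_of_notMem (by simpa using hy), mul_zero, add_zero]
      refine (lintegral_mono_ae (g := fun _ => 0) ?_).trans (by simp)
      filter_upwards [hF] with x' hx'
      refine (ih (y + x')).trans ?_
      rw [if_neg (by linarith)]

/-- Wald's inequality for the renewal function. -/
lemma truncMean_mul_renewalFun_le (hF : ∀ᵐ x ∂F, 0 ≤ x) {a : ℝ} (ha : 0 ≤ a) {t : ℝ}
    (ht : 0 ≤ t) : truncMean F a * renewalFun F t ≤ ENNReal.ofReal (t + a) := by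
  rw [renewalFun, ← ENNReal.tsum_mul_left]
  refine ENNReal.tsum_le_of_sum_range_le fun R => ?_
  rw [← Finset.mul_sum]
  simpa only [zero_add, Set.preimage_id', ht, if_true, sub_zero] using sum_walkLaw_Iic_le hF ha t R 0

end Renewal

/-! ### Asymptotic translation invariance of the walk -/

namespace Renewal
variable {F : Measure ℝ} [IsProbabilityMeasure F]

lemma integrable_of_mem_Icc {μ : Measure ℝ} [IsFiniteMeasure μ] {f : ℝ → ℝ} (hf : Measurable f)
    {c d : ℝ} (h : ∀ t, f t ∈ Set.Icc c d) : Integrable f μ :=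
  Integrable.of_bound hf.aestronglyMeasurable (max |c| |d|)
    (ae_of_all _ fun t => abs_le_max_abs_abs (h t).1 (h t).2)

lemma integral_mem_Icc {μ : Measure ℝ} [IsProbabilityMeasure μ] {f : ℝ → ℝ} (hf : Measurable f)
    {c d : ℝ} (h : ∀ t, f t ∈ Set.Icc c d) : ∫ t, f t ∂μ ∈ Set.Icc c d := by
  have hi := integrable_of_mem_Icc (μ := μ) hf h
  constructor
  · simpa using integral_mono (μ := μ) (integrable_const c) hi fun t => (h t).1
  · simpa using integral_mono (μ := μ) hi (integrable_const d) fun t => (h t).2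

lemma integral_walkLaw_succ (n : ℕ) {f : ℝ → ℝ} (hf : Measurable f)
    (h : ∀ t, f t ∈ Set.Icc (0 : ℝ) 1) :
    ∫ z, f z ∂(walkLaw F (n + 1)) = ∫ x, ∫ t, f (x + t) ∂(walkLaw F n) ∂F := by
  have : Integrable f (F ∗ walkLaw F n) := integrable_of_mem_Icc hf h
  rw [walkLaw, Measure.conv_comm, integral_conv this]

/-- If the translates of `F` to the right are dominated by multiples of `F`, then the law of `S_g`
is asymptotically invariant under translations. -/
lemma integral_walkLaw_le_shift {θ : ℝ} (hθ : 0 ≤ θ)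
    (hF : ∀ t, 0 ≤ t → F.map (· + t) ≤ ENNReal.ofReal (Real.exp (θ * t)) • F)
    {x : ℝ} (hx : 0 ≤ x) (n g : ℕ) {f : ℝ → ℝ} (hf : Measurable f)
    (h : ∀ t, f t ∈ Set.Icc (0 : ℝ) 1) :
    ∫ t, f t ∂(walkLaw F g) ≤ ∫ t, f (t + x) ∂(walkLaw F g)
      + (1 / (n + 1) + (1 - Real.exp (-(θ * (n * x)))) ^ g) := by
  induction g generalizing f with
  | zero =>
    simp only [walkLaw, integral_dirac, pow_zero, zero_add]
    have h1 := (h 0).2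
    have h2 := (h x).1
    have : (0 : ℝ) ≤ 1 / (n + 1) := by positivity
    linarith
  | succ g ih =>
    set q := Real.exp (-(θ * (n * x))) with hq
    set d : ℝ := 1 / (n + 1) + (1 - q) ^ g with hd
    have hq0 : 0 < q := Real.exp_pos _
    have hq1 : q ≤ 1 := Real.exp_le_one_iff.2 (by simpa using by positivity)
    have hd0 : 0 ≤ d := add_nonneg (by positivity) (pow_nonneg (by linarith) _)
    have hfy : ∀ y, Measurable fun t => f (y + t) := fun y => by fun_prop
    set p : ℝ → ℝ := fun y => ∫ t, f (y + t) ∂(walkLaw F g) with hp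
    have hpm : Measurable p := by
      have : Measurable fun z : ℝ × ℝ => f (z.1 + z.2) := by fun_prop
      exact this.stronglyMeasurable.integral_prod_right'.measurable
    have hp01 : ∀ y, p y ∈ Set.Icc (0 : ℝ) 1 := fun y => integral_mem_Icc (hfy y) fun t => h _
    have hpi : ∀ y, Integrable (fun t => p (t + y)) F := fun y =>
      integrable_of_mem_Icc (by fun_prop) fun t => hp01 _
    have hpi0 : Integrable p F := integrable_of_mem_Icc hpm hp01
    have h1 : ∫ t, f t ∂(walkLaw F (g + 1)) = ∫ y, p y ∂F := integral_walkLaw_succ g hf h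
    have h2 : ∫ t, f (t + x) ∂(walkLaw F (g + 1)) = ∫ y, p (y + x) ∂F := by
      rw [integral_walkLaw_succ g (f := fun t => f (t + x)) (by fun_prop) fun t => h _]
      simp only [hp, add_assoc, add_comm x]
    -- The induction hypothesis for the translates of `f` says precisely that `v ≥ 0`, and only
    -- nonnegative functions can be compared through the domination `hF`.
    set v : ℝ → ℝ := fun y => d + p (y + x) - p y with hv
    have hvm : Measurable v := by fun_prop
    have hv0 : ∀ y, 0 ≤ v y := fun y => by
      have := ih (hfy y) fun t => h _
      simp only [hv, hp]
      simp only [← add_assoc, add_right_comm y x] at this ⊢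
      linarith
    have hvi : ∀ y, Integrable (fun t => v (t + y)) F := fun y => by
      simp only [hv]
      exact ((integrable_const d).add (by simpa [add_assoc] using hpi (y + x))).sub (hpi y)
    have hvi0 : Integrable v F := by simpa using hvi 0
    have hda : ∀ y, Integrable (fun t => d + p (t + y)) F := fun y =>
      (integrable_const d).add (hpi y)
    -- A translation by `k * x` with `k ≤ n` costs at most `exp (θ * (n * x)) = q⁻¹`.
    have hdom : ∀ k ∈ Finset.range (n + 1), ∫ y, v (y + k * x) ∂F ≤ q⁻¹ * ∫ y, v y ∂F := by
      intro k hk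
      have hk' : (k : ℝ) ≤ n := by exact_mod_cast Finset.mem_range_succ_iff.1 hk
      have hle := hF (k * x) (by positivity)
      have := integral_mono_measure hle (ae_of_all _ hv0)
        (hvi0.smul_measure ENNReal.ofReal_ne_top)
      rw [integral_map (by fun_prop) hvm.aestronglyMeasurable, integral_smul_measure,
        ENNReal.toReal_ofReal (Real.exp_pos _).le, smul_eq_mul] at this
      refine this.trans (mul_le_mul_of_nonneg_right ?_ (integral_nonneg hv0))
      rw [hq, ← Real.exp_neg, neg_neg]
      exact Real.exp_le_exp.2 (by gcongr)
    have hsum := Finset.sum_le_sum hdom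
    have hstep : ∀ k : ℕ, ∫ y, v (y + k * x) ∂F
        = d + (∫ y, p (y + (k + 1 : ℕ) * x) ∂F - ∫ y, p (y + k * x) ∂F) := by
      intro k
      simp only [hv]
      have e : ∀ y, y + k * x + x = y + (k + 1 : ℕ) * x := fun y => by push_cast; ring
      simp only [e]
      rw [integral_sub (hda _) (hpi _),
        integral_add (integrable_const d) (hpi _)]
      simp
      ring
    -- The differences of `p` telescope. Since `p` lies in `[0, 1]`, the sum over the `n + 1`
    -- translates is at least `(n + 1) * d - 1`.
    rw [Finset.sum_congr rfl fun k _ => hstep k, Finset.sum_add_distrib,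
      Finset.sum_range_sub (fun k : ℕ => ∫ y, p (y + k * x) ∂F)] at hsum
    simp only [Finset.sum_const, Finset.card_range, nsmul_eq_mul] at hsum
    have hb1 := (integral_mem_Icc (μ := F) (f := fun y => p (y + (n + 1 : ℕ) * x))
      (by fun_prop) fun t => hp01 _).1
    have hb2 := (integral_mem_Icc (μ := F) (f := fun y => p (y + (0 : ℕ) * x))
      (by fun_prop) fun t => hp01 _).2
    have hvint : ∫ y, v y ∂F = d + ∫ y, p (y + x) ∂F - ∫ y, p y ∂F := by
      simp only [hv]
      rw [integral_sub (hda _) hpi0,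
        integral_add (integrable_const d) (hpi _)]
      simp
    have hn : (0 : ℝ) < ((n + 1 : ℕ) : ℝ) := by positivity
    -- Since `d - 1 / (n + 1) = (1 - q) ^ g`, this lower bound removes the fraction `q` of the power
    -- term and leaves `(1 - q) ^ (g + 1)`.
    have key : q * (d - 1 / (n + 1)) ≤ ∫ y, v y ∂F := by
      have h3 : ((n + 1 : ℕ) : ℝ) * d - 1 ≤ ((n + 1 : ℕ) : ℝ) * (q⁻¹ * ∫ y, v y ∂F) := by
        refine le_trans ?_ hsum
        linarith only [hb1, hb2]
      have h4 : d - 1 / (n + 1) ≤ q⁻¹ * ∫ y, v y ∂F := by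
        have h5 : ((n + 1 : ℕ) : ℝ) * (d - 1 / (n + 1)) = ((n + 1 : ℕ) : ℝ) * d - 1 := by
          push_cast
          field_simp
        exact le_of_mul_le_mul_left (h5 ▸ h3) hn
      calc q * (d - 1 / (n + 1)) ≤ q * (q⁻¹ * ∫ y, v y ∂F) := by gcongr
        _ = _ := by field_simp
    have h6 : d - 1 / (n + 1) = (1 - q) ^ g := by simp [hd]
    rw [h6] at key
    rw [h1, h2, pow_succ]
    nlinarith

/-- The `ℝ≥0∞`-valued version of `integral_walkLaw_le_shift`. -/
lemma lintegral_walkLaw_le_shift {θ : ℝ} (hθ : 0 ≤ θ)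
    (hF : ∀ t, 0 ≤ t → F.map (· + t) ≤ ENNReal.ofReal (Real.exp (θ * t)) • F)
    {x : ℝ} (hx : 0 ≤ x) (n g : ℕ) {f : ℝ → ℝ≥0∞} (hf : Measurable f) {C : ℝ≥0∞} (hC : C ≠ ∞)
    (h : ∀ t, f t ≤ C) :
    ∫⁻ t, f t ∂(walkLaw F g) ≤ ∫⁻ t, f (t + x) ∂(walkLaw F g)
      + C * ENNReal.ofReal (1 / (n + 1) + (1 - Real.exp (-(θ * (n * x)))) ^ g) := by
  rcases eq_or_ne C 0 with rfl | hC0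
  · simp [fun t => le_zero_iff.1 (h t)]
  set u : ℝ → ℝ := fun t => (f t / C).toReal with hu
  have hle : ∀ t, f t / C ≤ 1 := fun t => ENNReal.div_le_of_le_mul (by simpa using h t)
  have hum : Measurable u := by fun_prop
  have hu01 : ∀ t, u t ∈ Set.Icc (0 : ℝ) 1 := fun t =>
    ⟨ENNReal.toReal_nonneg, ENNReal.toReal_le_of_le_ofReal zero_le_one (by simpa using hle t)⟩
  have hfu : ∀ t, f t = C * ENNReal.ofReal (u t) := fun t => by
    rw [hu, ENNReal.ofReal_toReal ((hle t).trans_lt ENNReal.one_lt_top).ne,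
      ENNReal.mul_div_cancel hC0 hC]
  have hI : ∀ y, ∫⁻ t, f (t + y) ∂(walkLaw F g)
      = C * ENNReal.ofReal (∫ t, u (t + y) ∂(walkLaw F g)) := fun y => by
    rw [ofReal_integral_eq_lintegral_ofReal (integrable_of_mem_Icc (by fun_prop) fun t => hu01 _)
      (ae_of_all _ fun t => (hu01 _).1), ← lintegral_const_mul _ (by fun_prop)]
    exact lintegral_congr fun t => hfu _
  have hI0 := hI 0
  simp only [add_zero] at hI0
  rw [hI0, hI x, ← mul_add]
  gcongr
  exact (ENNReal.ofReal_le_ofReal (integral_walkLaw_le_shift hθ hF hx n g hum hu01)).trans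
    ENNReal.ofReal_add_le

end Renewal

/-! ### Expected crossings: uniform bound and limit superior -/

namespace Renewal
variable {F : Measure ℝ}

lemma tsum_walkLaw_Ioc_add (t : ℝ) {x y : ℝ} (hx : 0 ≤ x) (hy : 0 ≤ y) :
    ∑' r, walkLaw F (r + 1) (Set.Ioc t (t + (x + y)))
      = ∑' r, walkLaw F (r + 1) (Set.Ioc t (t + x))
        + ∑' r, walkLaw F (r + 1) (Set.Ioc (t + x) (t + x + y)) := by
  rw [← ENNReal.tsum_add]
  refine tsum_congr fun r => ?_
  rw [← add_assoc, ← Set.Ioc_union_Ioc_eq_Ioc (b := t + x) (by linarith) (by linarith),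
    measure_union (Set.Ioc_disjoint_Ioc_of_le le_rfl) measurableSet_Ioc]

lemma tendsto_truncMean : Tendsto (fun n : ℕ => truncMean F (n + 1)) atTop
    (𝓝 (∫⁻ x, ENNReal.ofReal x ∂F)) := by
  refine lintegral_tendsto_of_tendsto_of_monotone (fun n => by fun_prop)
    (ae_of_all _ fun x m n hmn => ?_) (ae_of_all _ fun x => ?_)
  · exact ENNReal.ofReal_le_ofReal (min_le_min_left _ (by gcongr))
  · refine tendsto_const_nhds.congr' ?_
    obtain ⟨N, hN⟩ := exists_nat_ge x
    filter_upwards [eventually_ge_atTop N] with n hn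
    rw [min_eq_left]
    have : (N : ℝ) ≤ n := by exact_mod_cast hn
    linarith

lemma sum_tsum_walkLaw_Ioc (t : ℝ) {x : ℝ} (hx : 0 ≤ x) (K : ℕ) :
    ∑ i ∈ Finset.range K, ∑' r, walkLaw F (r + 1) (Set.Ioc (t + i * x) (t + i * x + x))
      = ∑' r, walkLaw F (r + 1) (Set.Ioc t (t + K * x)) := by
  induction K with
  | zero => simp
  | succ K ih =>
    rw [Finset.sum_range_succ, ih, ← tsum_walkLaw_Ioc_add t (by positivity) hx]
    simp [add_mul]

variable [IsProbabilityMeasure F]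

lemma measurable_walkLaw_Ioc (r : ℕ) :
    Measurable fun z : ℝ × ℝ => walkLaw F r (Set.Ioc z.1 (z.1 + z.2)) := by
  have hs : MeasurableSet ({y : (ℝ × ℝ) × ℝ | y.1.1 < y.2} ∩ {y | y.2 ≤ y.1.1 + y.1.2}) :=
    (measurableSet_lt (by fun_prop) (by fun_prop)).inter
      (measurableSet_le (by fun_prop) (by fun_prop))
  have h := measurable_measure_prodMk_left (ν := walkLaw F r) hs
  have he : ∀ z : ℝ × ℝ, Prod.mk z ⁻¹' ({y : (ℝ × ℝ) × ℝ | y.1.1 < y.2} ∩ {y | y.2 ≤ y.1.1 + y.1.2})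
      = Set.Ioc z.1 (z.1 + z.2) := fun z => by ext; simp
  simpa only [he] using h

lemma measurable_tsum_walkLaw_Ioc :
    Measurable fun z : ℝ × ℝ => ∑' r, walkLaw F (r + 1) (Set.Ioc z.1 (z.1 + z.2)) :=
  Measurable.tsum fun r => measurable_walkLaw_Ioc (r + 1)

lemma crossings_eq_tsum (g : ℕ) : crossings F g
    = ∑' r, ∫⁻ t, ∫⁻ x, walkLaw F (r + 1) (Set.Ioc t (t + x)) ∂F ∂(walkLaw F g) := by
  rw [crossings, ← lintegral_tsum fun r =>
    (measurable_walkLaw_Ioc (F := F) (r + 1)).lintegral_prod_right'.aemeasurable]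
  refine lintegral_congr fun t => ?_
  exact lintegral_tsum fun r =>
    ((measurable_walkLaw_Ioc (F := F) (r + 1)).comp measurable_prodMk_left).aemeasurable

lemma lintegral_tsum_walkLaw_Ioc_le (g : ℕ) (x : ℝ) :
    ∫⁻ t, ∑' r, walkLaw F (r + 1) (Set.Ioc t (t + x)) ∂(walkLaw F g) ≤ renewalFun F x :=
  (lintegral_mono fun t => tsum_walkLaw_succ_Ioc_le t x).trans (by simp)

lemma crossings_eq (g : ℕ) : crossings F g
    = ∫⁻ x, ∫⁻ t, ∑' r, walkLaw F (r + 1) (Set.Ioc t (t + x)) ∂(walkLaw F g) ∂F :=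
  lintegral_lintegral_swap measurable_tsum_walkLaw_Ioc.aemeasurable

lemma truncMean_ne_top (a : ℝ) : truncMean F a ≠ ∞ :=
  ((lintegral_mono fun _ => ENNReal.ofReal_le_ofReal (min_le_right _ a)).trans_lt
    (by simp : ∫⁻ _, ENNReal.ofReal a ∂F < ∞)).ne

lemma truncMean_ne_zero (hF : ∀ᵐ x ∂F, 0 < x) {a : ℝ} (ha : 0 < a) : truncMean F a ≠ 0 := by
  rw [truncMean, Ne, lintegral_eq_zero_iff (by fun_prop)]
  intro h
  obtain ⟨x, hx, hx'⟩ := (hF.and h).exists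
  simp only [Pi.zero_apply, ENNReal.ofReal_eq_zero] at hx'
  exact absurd hx' (not_le.2 (lt_min hx ha))

lemma renewalFun_le_div (hF : ∀ᵐ x ∂F, 0 < x) {a : ℝ} (ha : 0 < a) {t : ℝ} (ht : 0 ≤ t) :
    renewalFun F t ≤ ENNReal.ofReal (t + a) / truncMean F a := by
  rw [ENNReal.le_div_iff_mul_le (Or.inl (truncMean_ne_zero hF ha))
    (Or.inl (truncMean_ne_top a)), mul_comm]
  exact truncMean_mul_renewalFun_le (hF.mono fun _ h => h.le) ha.le ht

lemma lintegral_renewalFun_le (hF : ∀ᵐ x ∂F, 0 < x) {a : ℝ} (ha : 0 < a) :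
    ∫⁻ x, renewalFun F x ∂F
      ≤ (∫⁻ x, ENNReal.ofReal x ∂F + ENNReal.ofReal a) / truncMean F a := by
  calc ∫⁻ x, renewalFun F x ∂F
      ≤ ∫⁻ x, (ENNReal.ofReal x + ENNReal.ofReal a) / truncMean F a ∂F := by
        refine lintegral_mono_ae ?_
        filter_upwards [hF] with x hx
        rw [← ENNReal.ofReal_add hx.le ha.le]
        exact renewalFun_le_div hF ha hx.le
    _ = _ := by
        simp only [div_eq_mul_inv]
        rw [lintegral_mul_const _ (by fun_prop), lintegral_add_right _ (by fun_prop)]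
        simp

/-- A bound for the expected number of crossings which holds at every step. -/
lemma crossings_le (hF : ∀ᵐ x ∂F, 0 < x) {a : ℝ} (ha : 0 < a) (g : ℕ) :
    crossings F g ≤ (∫⁻ x, ENNReal.ofReal x ∂F + ENNReal.ofReal a) / truncMean F a := by
  rw [crossings_eq]
  exact (lintegral_mono fun x => lintegral_tsum_walkLaw_Ioc_le g x).trans
    (lintegral_renewalFun_le hF ha)

/-- A weak substitute for the renewal theorem. By translation invariance, `K` adjacent windows of
length `x` each receive asymptotically at least `φ g`, up to an error, while their union receives at
most `(K * x + a) / truncMean F a`. -/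
lemma limsup_lintegral_tsum_walkLaw_le (hF : ∀ᵐ x ∂F, 0 < x) {θ : ℝ} (hθ : 0 ≤ θ)
    (hdom : ∀ t, 0 ≤ t → F.map (· + t) ≤ ENNReal.ofReal (Real.exp (θ * t)) • F)
    {a : ℝ} (ha : 0 < a) {x : ℝ} (hx : 0 ≤ x) :
    limsup (fun g => ∫⁻ t, ∑' r, walkLaw F (r + 1) (Set.Ioc t (t + x)) ∂(walkLaw F g)) atTop
      ≤ ENNReal.ofReal x / truncMean F a := by
  set φ : ℕ → ℝ≥0∞ :=
    fun g => ∫⁻ t, ∑' r, walkLaw F (r + 1) (Set.Ioc t (t + x)) ∂(walkLaw F g) with hφ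
  have hτ0 := truncMean_ne_zero hF ha
  have hM : renewalFun F x ≠ ∞ :=
    ((renewalFun_le_div hF ha hx).trans_lt
      (ENNReal.div_lt_top ENNReal.ofReal_ne_top hτ0)).ne
  have hmeas : Measurable fun t => ∑' r, walkLaw F (r + 1) (Set.Ioc t (t + x)) :=
    measurable_tsum_walkLaw_Ioc.comp (measurable_id.prodMk measurable_const)
  -- Error of the shift by `i * x`. The free parameter of the shift estimate is set to the number
  -- `K` of windows, so that the part that survives `g → ∞` vanishes as `K → ∞`.
  set err : ℕ → ℕ → ℕ → ℝ := fun K g i =>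
    1 / (K + 1) + (1 - Real.exp (-(θ * (K * (i * x))))) ^ g with herr
  have h1 : ∀ K g : ℕ, (K : ℝ≥0∞) * φ g ≤ ENNReal.ofReal (K * x + a) / truncMean F a
      + ∑ i ∈ Finset.range K, renewalFun F x * ENNReal.ofReal (err K g i) := by
    intro K g
    calc (K : ℝ≥0∞) * φ g = ∑ i ∈ Finset.range K, φ g := by simp
      _ ≤ ∑ i ∈ Finset.range K,
          (∫⁻ t, ∑' r, walkLaw F (r + 1) (Set.Ioc (t + i * x) (t + i * x + x)) ∂(walkLaw F g)
            + renewalFun F x * ENNReal.ofReal (err K g i)) :=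
        Finset.sum_le_sum fun i _ => lintegral_walkLaw_le_shift hθ hdom (by positivity) K g hmeas
          hM fun t => tsum_walkLaw_succ_Ioc_le t x
      _ ≤ _ := by
        rw [Finset.sum_add_distrib]
        gcongr
        have hm : ∀ i : ℕ, Measurable fun t =>
            ∑' r, walkLaw F (r + 1) (Set.Ioc (t + i * x) (t + i * x + x)) := fun i =>
          hmeas.comp (measurable_add_const (i * x))
        rw [← lintegral_finsetSum _ fun i _ => hm i]
        simp only [sum_tsum_walkLaw_Ioc _ hx]
        exact (lintegral_tsum_walkLaw_Ioc_le g _).trans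
          (renewalFun_le_div hF ha (by positivity))
  -- With `K + 1` windows fixed, `g → ∞` kills the power terms. Only afterwards does the number of
  -- windows grow.
  have h2 : ∀ K : ℕ, limsup φ atTop ≤ ENNReal.ofReal (x + a / (K + 1 : ℕ)) / truncMean F a
      + renewalFun F x * ENNReal.ofReal (1 / ((K + 1 : ℕ) + 1)) := by
    intro K
    have hK0 : ((K + 1 : ℕ) : ℝ≥0∞) ≠ 0 := by simp
    have hKt : ((K + 1 : ℕ) : ℝ≥0∞) ≠ ∞ := ENNReal.natCast_ne_top _
    have hlim : Tendsto (fun g => (ENNReal.ofReal ((K + 1 : ℕ) * x + a) / truncMean F a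
        + ∑ i ∈ Finset.range (K + 1), renewalFun F x * ENNReal.ofReal (err (K + 1) g i))
          / (K + 1 : ℕ)) atTop (𝓝 ((ENNReal.ofReal ((K + 1 : ℕ) * x + a) / truncMean F a
        + ∑ i ∈ Finset.range (K + 1),
          renewalFun F x * ENNReal.ofReal (1 / ((K + 1 : ℕ) + 1))) / (K + 1 : ℕ))) := by
      refine ENNReal.Tendsto.div_const (Tendsto.add tendsto_const_nhds ?_) (Or.inr hK0)
      refine tendsto_finsetSum _ fun i _ => ENNReal.Tendsto.const_mul ?_ (Or.inr hM)
      refine ENNReal.tendsto_ofReal ?_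
      have hq0 : 0 < Real.exp (-(θ * ((K + 1 : ℕ) * (i * x)))) := Real.exp_pos _
      have hq1 : Real.exp (-(θ * ((K + 1 : ℕ) * (i * x)))) ≤ 1 :=
        Real.exp_le_one_iff.2 (by simpa using by positivity)
      have := (tendsto_pow_atTop_nhds_zero_of_lt_one (sub_nonneg.2 hq1)
        (by linarith : 1 - Real.exp (-(θ * ((K + 1 : ℕ) * (i * x)))) < 1)).const_add
          (1 / (((K + 1 : ℕ) : ℝ) + 1))
      simpa [herr] using this
    refine (limsup_le_limsup (Eventually.of_forall fun g => ?_)).trans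
      (hlim.limsup_eq.le.trans ?_)
    · show φ g ≤ _
      rw [ENNReal.le_div_iff_mul_le (Or.inl hK0) (Or.inl hKt), mul_comm]
      exact h1 (K + 1) g
    · rw [ENNReal.div_le_iff_le_mul (Or.inl hK0) (Or.inl hKt)]
      have hk : ENNReal.ofReal ((K + 1 : ℕ) * x + a) / truncMean F a
          = ENNReal.ofReal (x + a / (K + 1 : ℕ)) / truncMean F a * (K + 1 : ℕ) := by
        rw [div_eq_mul_inv, div_eq_mul_inv, mul_right_comm, ← ENNReal.ofReal_natCast,
          ← ENNReal.ofReal_mul (by positivity)]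
        congr 2
        field_simp
      rw [Finset.sum_const, Finset.card_range, nsmul_eq_mul, add_mul, hk, mul_comm (_ * _)]
  have h3 : Tendsto (fun K : ℕ => ENNReal.ofReal (x + a / (K + 1 : ℕ)) / truncMean F a
      + renewalFun F x * ENNReal.ofReal (1 / ((K + 1 : ℕ) + 1))) atTop
      (𝓝 (ENNReal.ofReal (x + 0) / truncMean F a + renewalFun F x * ENNReal.ofReal 0)) := by
    refine Tendsto.add (ENNReal.Tendsto.div_const (ENNReal.tendsto_ofReal ?_) (Or.inr hτ0))
      (ENNReal.Tendsto.const_mul (ENNReal.tendsto_ofReal ?_) (Or.inr hM))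
    · exact ((tendsto_const_div_atTop_nhds_zero_nat a).comp (tendsto_add_atTop_nat 1)).const_add x
    · exact (tendsto_one_div_add_atTop_nhds_zero_nat (𝕜 := ℝ)).comp (tendsto_add_atTop_nat 1)
  simpa using ge_of_tendsto' h3 h2

/-- Reverse Fatou in the window length `x`, with `renewalFun F` as dominating function. It is
integrable because it grows at most linearly and `F` has finite mean. -/
lemma limsup_crossings_le_div (hF : ∀ᵐ x ∂F, 0 < x) {θ : ℝ} (hθ : 0 ≤ θ)
    (hdom : ∀ t, 0 ≤ t → F.map (· + t) ≤ ENNReal.ofReal (Real.exp (θ * t)) • F)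
    (hmean : ∫⁻ x, ENNReal.ofReal x ∂F ≠ ∞) {a : ℝ} (ha : 0 < a) :
    limsup (crossings F) atTop ≤ (∫⁻ x, ENNReal.ofReal x ∂F) / truncMean F a := by
  have hfin : ∫⁻ x, renewalFun F x ∂F ≠ ∞ :=
    ((lintegral_renewalFun_le hF ha).trans_lt (ENNReal.div_lt_top
      (ENNReal.add_ne_top.2 ⟨hmean, ENNReal.ofReal_ne_top⟩) (truncMean_ne_zero hF ha))).ne
  have hm : ∀ g, Measurable fun x =>
      ∫⁻ t, ∑' r, walkLaw F (r + 1) (Set.Ioc t (t + x)) ∂(walkLaw F g) := fun g =>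
    measurable_tsum_walkLaw_Ioc.lintegral_prod_left'
  calc limsup (crossings F) atTop
      = limsup (fun g => ∫⁻ x, ∫⁻ t, ∑' r, walkLaw F (r + 1) (Set.Ioc t (t + x))
          ∂(walkLaw F g) ∂F) atTop := by
        congr 1
        exact funext crossings_eq
    _ ≤ ∫⁻ x, limsup (fun g => ∫⁻ t, ∑' r, walkLaw F (r + 1) (Set.Ioc t (t + x))
          ∂(walkLaw F g)) atTop ∂F :=
        limsup_lintegral_le _ hm
          (fun g => ae_of_all _ fun x => lintegral_tsum_walkLaw_Ioc_le g x) hfin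
    _ ≤ ∫⁻ x, ENNReal.ofReal x / truncMean F a ∂F := by
        refine lintegral_mono_ae ?_
        filter_upwards [hF] with x hx
        exact limsup_lintegral_tsum_walkLaw_le hF hθ hdom ha hx.le
    _ = _ := by
        simp only [div_eq_mul_inv]
        rw [lintegral_mul_const _ (by fun_prop)]

/-- In the long run, one walk is renewed at most once on average during a step of an independent
copy. -/
theorem limsup_crossings_le_one (hF : ∀ᵐ x ∂F, 0 < x) {θ : ℝ} (hθ : 0 ≤ θ)
    (hdom : ∀ t, 0 ≤ t → F.map (· + t) ≤ ENNReal.ofReal (Real.exp (θ * t)) • F)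
    (hmean : ∫⁻ x, ENNReal.ofReal x ∂F ≠ ∞) : limsup (crossings F) atTop ≤ 1 := by
  have h0 : ∫⁻ x, ENNReal.ofReal x ∂F ≠ 0 := fun h =>
    truncMean_ne_zero hF one_pos (le_zero_iff.1 ((lintegral_mono fun x =>
      ENNReal.ofReal_le_ofReal (min_le_left x 1)).trans h.le))
  -- The truncation level tends to infinity last, and the ratio of the mean to the truncated mean
  -- tends to `1`.
  have h1 := ENNReal.Tendsto.const_div (a := ∫⁻ x, ENNReal.ofReal x ∂F)
    (tendsto_truncMean (F := F)) (Or.inr hmean)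
  rw [ENNReal.div_self h0 hmean] at h1
  exact ge_of_tendsto' h1 fun n => limsup_crossings_le_div hF hθ hdom hmean (by positivity)

end Renewal

/-! ### Ranks and order statistics -/

namespace AHFL

variable {ℓ : ℕ}

lemma rank_lt_card {s : Finset (Fin ℓ)} (x : Fin ℓ → ℝ) {i : Fin ℓ} (hi : i ∈ s) :
    rank s x i < s.card :=
  Finset.card_lt_card (Finset.filter_ssubset.2 ⟨i, hi, by simp⟩)

lemma rank_lt_rank {s : Finset (Fin ℓ)} {x : Fin ℓ → ℝ} {i j : Fin ℓ} (hj : j ∈ s)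
    (h : x j < x i ∨ (x j = x i ∧ j < i)) : rank s x j < rank s x i := by
  refine Finset.card_lt_card ?_
  rw [Finset.ssubset_iff_of_subset]
  · exact ⟨j, by simp [hj, h], by simp⟩
  · intro r hr
    simp only [Finset.mem_filter] at hr ⊢
    refine ⟨hr.1, ?_⟩
    rcases hr.2 with h1 | h1 <;> rcases h with h2 | h2
    · exact Or.inl (h1.trans h2)
    · exact Or.inl (h2.1 ▸ h1)
    · exact Or.inl (h1.1 ▸ h2)
    · exact Or.inr ⟨h1.1.trans h2.1, h1.2.trans h2.2⟩

lemma rank_injOn (s : Finset (Fin ℓ)) (x : Fin ℓ → ℝ) : Set.InjOn (rank s x) s := by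
  intro i hi j hj h
  by_contra hne
  rcases lt_trichotomy (x i) (x j) with h1 | h1 | h1
  · exact (rank_lt_rank hi (Or.inl h1)).ne h
  · rcases lt_or_gt_of_ne hne with h2 | h2
    · exact (rank_lt_rank hi (Or.inr ⟨h1, h2⟩)).ne h
    · exact (rank_lt_rank hj (Or.inr ⟨h1.symm, h2⟩)).ne h.symm
  · exact (rank_lt_rank hj (Or.inl h1)).ne h.symm

lemma earliest_subset (q : ℕ) (s : Finset (Fin ℓ)) (x : Fin ℓ → ℝ) : earliest q s x ⊆ s :=
  Finset.filter_subset _ _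

/-- Breaking ties by label makes the order strict and total, so the rank is a bijection of `s` onto
`0, …, s.card - 1` even when times coincide. -/
lemma card_earliest {q : ℕ} {s : Finset (Fin ℓ)} (x : Fin ℓ → ℝ) (hq : q ≤ s.card) :
    (earliest q s x).card = q := by
  have himg : s.image (rank s x) = Finset.range s.card := by
    refine Finset.eq_of_subset_of_card_le (fun r hr => ?_) ?_
    · obtain ⟨i, hi, rfl⟩ := Finset.mem_image.1 hr
      exact Finset.mem_range.2 (rank_lt_card x hi)
    · rw [Finset.card_image_of_injOn (rank_injOn s x), Finset.card_range]
  have h : (earliest q s x).image (rank s x) = Finset.range q := by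
    ext r
    simp only [earliest, Finset.mem_image, Finset.mem_filter, Finset.mem_range]
    constructor
    · rintro ⟨i, hi, rfl⟩
      exact hi.2
    · intro hr
      have : r ∈ s.image (rank s x) := himg ▸ Finset.mem_range.2 (hr.trans_le hq)
      obtain ⟨i, hi, rfl⟩ := Finset.mem_image.1 this
      exact ⟨i, ⟨hi, hr⟩, rfl⟩
  have h' := congrArg Finset.card h
  rwa [Finset.card_range, Finset.card_image_of_injOn
    ((rank_injOn s x).mono (Finset.coe_subset.2 (earliest_subset q s x)))] at h'

lemma le_of_mem_earliest {q : ℕ} {s : Finset (Fin ℓ)} {x : Fin ℓ → ℝ} {i j : Fin ℓ}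
    (hi : i ∈ earliest q s x) (hj : j ∈ s) (hj' : j ∉ earliest q s x) : x i ≤ x j := by
  by_contra h
  have h1 := rank_lt_rank hj (Or.inl (not_le.1 h))
  simp only [earliest, Finset.mem_filter] at hi hj'
  exact hj' ⟨hj, h1.trans hi.2⟩

lemma exists_lastTime_eq {s : Finset (Fin ℓ)} (hs : s.Nonempty) (x : Fin ℓ → ℝ) :
    ∃ i ∈ s, lastTime s x = x i := by
  rw [lastTime, dif_pos hs]
  exact Finset.exists_mem_eq_sup' hs x

lemma le_lastTime {s : Finset (Fin ℓ)} {i : Fin ℓ} (hi : i ∈ s) (x : Fin ℓ → ℝ) :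
    x i ≤ lastTime s x := by
  rw [lastTime, dif_pos ⟨i, hi⟩]
  exact Finset.le_sup' x hi

lemma lastTime_eq_of {s : Finset (Fin ℓ)} {x : Fin ℓ → ℝ} {v : ℝ} (h1 : ∀ i ∈ s, x i ≤ v)
    (h2 : ∃ i ∈ s, x i = v) : lastTime s x = v := by
  obtain ⟨i, hi, rfl⟩ := h2
  obtain ⟨j, hj, hj'⟩ := exists_lastTime_eq ⟨i, hi⟩ x
  exact le_antisymm (hj' ▸ h1 j hj) (le_lastTime hi x)

/-- The `q`-th order statistic of nonnegative numbers is bounded by their sum. -/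
lemma mul_lastTime_earliest_le {q : ℕ} {s : Finset (Fin ℓ)} {x : Fin ℓ → ℝ} (hx : ∀ i ∈ s, 0 ≤ x i)
    (hq : 0 < q) (hqs : q ≤ s.card) :
    ((s.card : ℝ) - q + 1) * lastTime (earliest q s x) x ≤ ∑ i ∈ s, x i := by
  have hcard := card_earliest x hqs
  obtain ⟨i, hi, hi'⟩ := exists_lastTime_eq (Finset.card_pos.1 (hcard.symm ▸ hq)) x
  -- The `s.card - q` elements outside are each at least the `q`-th value. The extra `1` is that
  -- value itself.
  rw [hi', ← Finset.sum_sdiff (earliest_subset q s x), add_mul, one_mul]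
  refine add_le_add ?_ (Finset.single_le_sum
    (fun j hj => hx j (earliest_subset q s x hj)) hi)
  have h : ∀ j ∈ s \ earliest q s x, x i ≤ x j := fun j hj =>
    le_of_mem_earliest hi (Finset.mem_sdiff.1 hj).1 (Finset.mem_sdiff.1 hj).2
  have := Finset.card_nsmul_le_sum _ _ _ h
  rw [Finset.card_sdiff_of_subset (earliest_subset q s x), hcard, nsmul_eq_mul,
    Nat.cast_sub hqs] at this
  exact this

lemma card_filter_lt_of_lastTime_lt {q : ℕ} {s : Finset (Fin ℓ)} {x : Fin ℓ → ℝ} {t : ℝ}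
    (hqs : q ≤ s.card) (h : lastTime (earliest q s x) x < t) :
    q ≤ (s.filter fun i => x i < t).card := by
  rw [← card_earliest x hqs]
  exact Finset.card_le_card fun i hi =>
    Finset.mem_filter.2 ⟨earliest_subset q s x hi, (le_lastTime hi x).trans_lt h⟩

lemma card_available {m : ℕ} (hm : m ≤ ℓ) (a : Fin ℓ → ℝ) : (available m a).card = m :=
  card_earliest a (by simpa using hm)

lemma card_aggregated {m k : ℕ} (hk : k ≤ m) (hm : m ≤ ℓ) (a u : Fin ℓ → ℝ) :
    (aggregated m k a u).card = k :=
  card_earliest u (by rwa [card_available hm])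

lemma available_nonempty {m : ℕ} (hm0 : 0 < m) (hm : m ≤ ℓ) (a : Fin ℓ → ℝ) :
    (available m a).Nonempty := Finset.card_pos.1 (by rwa [card_available hm])

lemma aggregated_nonempty {m k : ℕ} (hk0 : 0 < k) (hk : k ≤ m) (hm : m ≤ ℓ) (a u : Fin ℓ → ℝ) :
    (aggregated m k a u).Nonempty := Finset.card_pos.1 (by rwa [card_aggregated hk hm])

lemma cycleDuration_pos {m k : ℕ} {c : ℝ} (hc : 0 ≤ c) (hk0 : 0 < k) (hk : k ≤ m) (hm : m ≤ ℓ)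
    {a u : Fin ℓ → ℝ} (ha : ∀ i, 0 < a i) (hu : ∀ i, 0 < u i) : 0 < cycleDuration m k c a u := by
  obtain ⟨i, -, hi⟩ := exists_lastTime_eq (available_nonempty (hk0.trans_le hk) hm a) a
  obtain ⟨j, -, hj⟩ := exists_lastTime_eq (aggregated_nonempty hk0 hk hm a u) u
  rw [cycleDuration, hi, hj]
  linarith [ha i, hu j]

/-! ### Effect of a common delay of the availability times -/

section Translation

lemma available_add_const (m : ℕ) (a : Fin ℓ → ℝ) (t : ℝ) :
    available m (fun i => a i + t) = available m a := by
  have h : ∀ i, rank Finset.univ (fun i => a i + t) i = rank Finset.univ a i := fun i => by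
    unfold rank
    congr 1
    ext j
    simp
  ext i
  simp [available, earliest, h]

/-- Selection depends on comparisons only, so the delay changes just the wait for availability. This
transfers the regularity of the exponential law to the duration law. -/
lemma cycleDuration_add_const {m k : ℕ} {c : ℝ} (hm0 : 0 < m) (hm : m ≤ ℓ) (a u : Fin ℓ → ℝ)
    (t : ℝ) : cycleDuration m k c (fun i => a i + t) u = cycleDuration m k c a u + t := by
  have h : lastTime (available m a) (fun i => a i + t) = lastTime (available m a) a + t := by
    obtain ⟨i, hi, hi'⟩ := exists_lastTime_eq (available_nonempty hm0 hm a) a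
    exact lastTime_eq_of (fun j hj => by linarith [le_lastTime hj a]) ⟨i, hi, by rw [hi']⟩
  simp only [cycleDuration, aggregated, available_add_const, h]
  ring

end Translation

/-! ### Equivariance under relabelling of the clients -/

section Permutation

/-- Tie-breaking by label is not equivariant, whence injectivity of `x`; for exponential times it
holds almost surely. -/
lemma mem_earliest_comp {q : ℕ} {s s' : Finset (Fin ℓ)} {x : Fin ℓ → ℝ}
    (hx : Function.Injective x) (σ : Equiv.Perm (Fin ℓ)) (hs : ∀ i, i ∈ s' ↔ σ i ∈ s)
    (i : Fin ℓ) : i ∈ earliest q s' (x ∘ σ) ↔ σ i ∈ earliest q s x := by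
  have h : rank s' (x ∘ σ) i = rank s x (σ i) := by
    refine Finset.card_bij (fun j _ => σ j) (fun j hj => ?_) (fun _ _ _ _ h => σ.injective h)
      fun j hj => ⟨σ.symm j, ?_, by simp⟩
    · simp only [Finset.mem_filter, Function.comp_apply, hs] at hj ⊢
      refine ⟨hj.1, hj.2.imp_right fun h => absurd h.2 ?_⟩
      rw [σ.injective (hx h.1)]
      exact lt_irrefl _
    · simp only [Finset.mem_filter, Function.comp_apply, hs, Equiv.apply_symm_apply] at hj ⊢
      refine ⟨hj.1, hj.2.imp_right fun h => absurd h.2 ?_⟩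
      rw [hx h.1]
      exact lt_irrefl _
  simp [earliest, hs, h]

lemma mem_available_comp {m : ℕ} {a : Fin ℓ → ℝ} (ha : Function.Injective a)
    (σ : Equiv.Perm (Fin ℓ)) (i : Fin ℓ) : i ∈ available m (a ∘ σ) ↔ σ i ∈ available m a :=
  mem_earliest_comp ha σ (by simp) i

lemma mem_aggregated_comp {m k : ℕ} {a u : Fin ℓ → ℝ} (ha : Function.Injective a)
    (hu : Function.Injective u) (σ : Equiv.Perm (Fin ℓ)) (i : Fin ℓ) :
    i ∈ aggregated m k (a ∘ σ) (u ∘ σ) ↔ σ i ∈ aggregated m k a u :=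
  mem_earliest_comp hu σ (mem_available_comp ha σ) i

lemma lastTime_comp {s s' : Finset (Fin ℓ)} (hs0 : s.Nonempty) (x : Fin ℓ → ℝ)
    (σ : Equiv.Perm (Fin ℓ)) (hs : ∀ i, i ∈ s' ↔ σ i ∈ s) :
    lastTime s' (x ∘ σ) = lastTime s x := by
  obtain ⟨i, hi, hi'⟩ := exists_lastTime_eq hs0 x
  exact lastTime_eq_of (fun j hj => le_lastTime ((hs j).1 hj) x)
    ⟨σ.symm i, (hs _).2 (by simpa using hi), by simp [hi']⟩

lemma cycleDuration_comp {m k : ℕ} {c : ℝ} (hk0 : 0 < k) (hk : k ≤ m) (hm : m ≤ ℓ)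
    {a u : Fin ℓ → ℝ} (ha : Function.Injective a) (hu : Function.Injective u)
    (σ : Equiv.Perm (Fin ℓ)) :
    cycleDuration m k c (a ∘ σ) (u ∘ σ) = cycleDuration m k c a u := by
  rw [cycleDuration, cycleDuration,
    lastTime_comp (available_nonempty (hk0.trans_le hk) hm a) a σ (mem_available_comp ha σ),
    lastTime_comp (aggregated_nonempty hk0 hk hm a u) u σ (mem_aggregated_comp ha hu σ)]

end Permutation

/-! ### Measurability of selections and durations -/

section Measurability

lemma measurableSet_mem_earliest (q : ℕ) (s : Finset (Fin ℓ)) (i : Fin ℓ) :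
    MeasurableSet {x : Fin ℓ → ℝ | i ∈ earliest q s x} := by
  have hr : Measurable fun x : Fin ℓ → ℝ => rank s x i := by
    simp only [rank, Finset.card_filter]
    refine Finset.measurable_sum _ fun j _ => Measurable.ite ?_ measurable_const measurable_const
    exact (measurableSet_lt (measurable_pi_apply j) (measurable_pi_apply i)).union
      ((measurableSet_eq_fun (measurable_pi_apply j) (measurable_pi_apply i)).inter
        (MeasurableSet.const _))
  simp only [earliest, Finset.mem_filter]
  exact (MeasurableSet.const _).inter (measurableSet_lt hr measurable_const)

/-- With the discrete structure, measurability of a function of a random set and a time vector can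
be checked one set at a time. -/
instance measurableSpaceFinset : MeasurableSpace (Finset (Fin ℓ)) := ⊤

instance discreteMeasurableSpaceFinset : DiscreteMeasurableSpace (Finset (Fin ℓ)) :=
  ⟨fun _ => trivial⟩

lemma measurable_earliest (q : ℕ) (s : Finset (Fin ℓ)) :
    Measurable fun x : Fin ℓ → ℝ => earliest q s x := by
  refine measurable_to_countable' fun V => ?_
  have : (fun x : Fin ℓ → ℝ => earliest q s x) ⁻¹' {V}
      = ⋂ i, {x | i ∈ earliest q s x ↔ i ∈ V} := by
    ext x
    simp [Finset.ext_iff]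
  rw [this]
  refine MeasurableSet.iInter fun i => ?_
  by_cases hi : i ∈ V
  · simp only [hi, iff_true]
    exact measurableSet_mem_earliest q s i
  · simp only [hi, iff_false]
    exact (measurableSet_mem_earliest q s i).compl

lemma measurable_available (m : ℕ) : Measurable fun a : Fin ℓ → ℝ => available m a :=
  measurable_earliest m _

lemma measurable_aggregated (m k : ℕ) :
    Measurable fun z : (Fin ℓ → ℝ) × (Fin ℓ → ℝ) => aggregated m k z.1 z.2 := by
  have h : Measurable fun w : Finset (Fin ℓ) × (Fin ℓ → ℝ) => earliest k w.1 w.2 :=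
    measurable_from_prod_countable_right fun s => measurable_earliest k s
  exact h.comp (((measurable_available m).comp measurable_fst).prodMk measurable_snd)

lemma measurableSet_mem_aggregated (m k : ℕ) (i : Fin ℓ) :
    MeasurableSet {z : (Fin ℓ → ℝ) × (Fin ℓ → ℝ) | i ∈ aggregated m k z.1 z.2} :=
  measurable_aggregated m k (MeasurableSet.of_discrete (s := {s | i ∈ s}))

lemma measurable_lastTime :
    Measurable fun w : Finset (Fin ℓ) × (Fin ℓ → ℝ) => lastTime w.1 w.2 := by
  refine measurable_from_prod_countable_right fun s => ?_
  by_cases hs : s.Nonempty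
  · have h := Finset.measurable_sup' hs (f := fun i (x : Fin ℓ → ℝ) => x i)
      fun i _ => measurable_pi_apply i
    simp only [lastTime, dif_pos hs]
    convert h using 1
    ext x
    simp [Finset.sup'_apply]
  · simp only [lastTime, dif_neg hs]
    exact measurable_const

lemma measurable_cycleDuration (m k : ℕ) (c : ℝ) :
    Measurable fun z : (Fin ℓ → ℝ) × (Fin ℓ → ℝ) => cycleDuration m k c z.1 z.2 := by
  have h0 : Measurable fun z : (Fin ℓ → ℝ) × (Fin ℓ → ℝ) => available m z.1 :=
    (measurable_available m).comp measurable_fst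
  have h1 := measurable_lastTime.comp (h0.prodMk measurable_fst)
  have h2 := measurable_lastTime.comp
    ((measurable_aggregated (ℓ := ℓ) m k).prodMk measurable_snd)
  exact (h1.add_const c).add h2

end Measurability

/-! ### The exponential law -/

section Exponential

lemma lintegral_expMeasure (r : ℝ) {f : ℝ → ℝ≥0∞} (hf : Measurable f) :
    ∫⁻ x, f x ∂(expMeasure r) = ∫⁻ x, exponentialPDF r x * f x :=
  lintegral_withDensity_eq_lintegral_mul _ (measurable_exponentialPDFReal r).ennreal_ofReal hf

instance nullSingletonClass_expMeasure (r : ℝ) : NullSingletonClass (expMeasure r) :=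
  ⟨fun x => withDensity_absolutelyContinuous _ _ (measure_singleton x)⟩

lemma ae_pos_expMeasure (r : ℝ) : ∀ᵐ x ∂(expMeasure r), 0 < x := by
  have h : expMeasure r (Set.Iic 0) = 0 := by
    rw [← lintegral_indicator_one measurableSet_Iic, lintegral_expMeasure r
      (measurable_one.indicator measurableSet_Iic), lintegral_eq_zero_iff
      (f := fun x => exponentialPDF r x * (Set.Iic (0 : ℝ)).indicator 1 x)
      ((measurable_exponentialPDFReal r).ennreal_ofReal.mul
        (measurable_one.indicator measurableSet_Iic))]
    have h0 : ∀ᵐ x : ℝ ∂volume, x ≠ 0 := by simp [ae_iff]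
    filter_upwards [h0] with x hx
    rcases lt_or_gt_of_ne hx with h | h
    · simp [exponentialPDF_of_neg h]
    · simp [h]
  rw [ae_iff]
  simpa [Set.Iic] using h

lemma lintegral_ofReal_expMeasure {r : ℝ} (hr : 0 < r) :
    ∫⁻ x, ENNReal.ofReal x ∂(expMeasure r) = ENNReal.ofReal (1 / r) := by
  rw [lintegral_expMeasure r (by fun_prop)]
  have h : ∀ x, exponentialPDF r x * ENNReal.ofReal x
      = ENNReal.ofReal (1 / r) * gammaPDF 2 r x := by
    intro x
    rcases lt_or_ge x 0 with hx | hx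
    · rw [exponentialPDF_of_neg hx, gammaPDF_of_neg hx, zero_mul, mul_zero]
    · rw [exponentialPDF_of_nonneg hx, gammaPDF_of_nonneg hx,
        ← ENNReal.ofReal_mul (by positivity), ← ENNReal.ofReal_mul (by positivity)]
      congr 1
      rw [Real.Gamma_two]
      norm_num
      field_simp
  simp only [h]
  have hm : Measurable (gammaPDF 2 r) := (measurable_gammaPDFReal 2 r).ennreal_ofReal
  rw [lintegral_const_mul _ hm, lintegral_gammaPDF_eq_one two_pos hr, mul_one]

lemma expMeasure_Iio_le {r : ℝ} (hr : 0 < r) (t : ℝ) :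
    expMeasure r (Set.Iio t) ≤ ENNReal.ofReal (r * t) := by
  have := isProbabilityMeasure_expMeasure hr
  refine (measure_mono Set.Iio_subset_Iic_self).trans ?_
  rw [← ofReal_cdf, cdf_expMeasure_eq hr]
  refine ENNReal.ofReal_le_ofReal_iff'.2 ?_
  split_ifs with h
  · left
    linarith [Real.add_one_le_exp (-(r * t))]
  · right
    exact le_rfl

/-- Memorylessness in density form: on `[t, ∞)` the density at `x - t` is `exp (r * t)` times the
density at `x`. -/
lemma map_add_const_expMeasure (r : ℝ) {t : ℝ} (ht : 0 ≤ t) :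
    (expMeasure r).map (· + t)
      = ENNReal.ofReal (Real.exp (r * t)) • (expMeasure r).restrict (Set.Ici t) := by
  refine Measure.ext_of_lintegral _ fun f hf => ?_
  rw [lintegral_map hf (by fun_prop), lintegral_smul_measure,
    ← lintegral_indicator measurableSet_Ici, lintegral_expMeasure r (by fun_prop),
    lintegral_expMeasure r (hf.indicator measurableSet_Ici),
    ← lintegral_sub_right_eq_self _ t, smul_eq_mul,
    ← lintegral_const_mul' _ _ ENNReal.ofReal_ne_top]
  refine lintegral_congr fun x => ?_
  rw [sub_add_cancel]
  rcases lt_or_ge x t with hx | hx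
  · rw [exponentialPDF_of_neg (by linarith), Set.indicator_of_notMem (by simpa using hx)]
    simp
  · rw [exponentialPDF_of_nonneg (by linarith), exponentialPDF_of_nonneg (ht.trans hx),
      Set.indicator_of_mem (by simpa using hx), ← mul_assoc,
      ← ENNReal.ofReal_mul (Real.exp_pos _).le, mul_left_comm, ← Real.exp_add]
    congr 4
    ring

end Exponential

/-! ### Independent exponential vectors and their order statistics -/

section ExponentialVector

variable {ℓ : ℕ}

/-- The law of a vector of independent exponential times with parameter `r`. -/
noncomputable def expVector (ℓ : ℕ) (r : ℝ) : Measure (Fin ℓ → ℝ) :=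
  Measure.pi fun _ => expMeasure r

lemma isProbabilityMeasure_expVector {r : ℝ} (hr : 0 < r) :
    IsProbabilityMeasure (expVector ℓ r) := by
  have := isProbabilityMeasure_expMeasure hr
  rw [expVector]
  infer_instance

lemma measurePreserving_eval_expVector {r : ℝ} (hr : 0 < r) (i : Fin ℓ) :
    MeasurePreserving (fun x : Fin ℓ → ℝ => x i) (expVector ℓ r) (expMeasure r) := by
  have := isProbabilityMeasure_expMeasure hr
  exact measurePreserving_eval _ i

lemma ae_pos_expVector {r : ℝ} (hr : 0 < r) : ∀ᵐ x ∂(expVector ℓ r), ∀ i, 0 < x i :=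
  ae_all_iff.2 fun i =>
    (measurePreserving_eval_expVector hr i).quasiMeasurePreserving.ae (ae_pos_expMeasure r)

lemma ae_injective_expVector {r : ℝ} (hr : 0 < r) :
    ∀ᵐ x ∂(expVector ℓ r), Function.Injective x := by
  have := isProbabilityMeasure_expMeasure hr
  have := isProbabilityMeasure_expVector (ℓ := ℓ) hr
  have h : ∀ i j : Fin ℓ, i ≠ j → ∀ᵐ x ∂(expVector ℓ r), x i ≠ x j := by
    intro i j hij
    have hind : iIndepFun (fun (i : Fin ℓ) (x : Fin ℓ → ℝ) => x i) (expVector ℓ r) :=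
      iIndepFun_pi (X := fun _ x => x) fun _ => aemeasurable_id
    have hmap := (hind.indepFun hij).map_prod_eq_prod_map_map
      (measurable_pi_apply i).aemeasurable (measurable_pi_apply j).aemeasurable
    rw [(measurePreserving_eval_expVector hr i).map_eq,
      (measurePreserving_eval_expVector hr j).map_eq] at hmap
    have hs : MeasurableSet {z : ℝ × ℝ | z.1 = z.2} :=
      measurableSet_eq_fun measurable_fst measurable_snd
    have h0 : ((expMeasure r).prod (expMeasure r)) {z : ℝ × ℝ | z.1 = z.2} = 0 := by
      rw [Measure.prod_apply hs]
      have : ∀ x : ℝ, Prod.mk x ⁻¹' {z : ℝ × ℝ | z.1 = z.2} = {x} := fun x => by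
        ext y
        simp [eq_comm]
      simp [this]
    rw [← hmap, Measure.map_apply (by fun_prop) hs] at h0
    rw [ae_iff]
    simpa using h0
  have h' : ∀ᵐ x ∂(expVector ℓ r), ∀ i j : Fin ℓ, i ≠ j → x i ≠ x j := by
    simpa only [ae_all_iff, Filter.eventually_imp_distrib_left] using h
  filter_upwards [h'] with x hx i j hij
  by_contra hne
  exact hx i j hne hij

/-- Each of the `ℓ` coordinates contributes a factor `exp (r * t)`. The restriction to `[t, ∞)^ℓ` is
then dropped. -/
lemma map_add_const_expVector_le {r : ℝ} (hr : 0 < r) {t : ℝ} (ht : 0 ≤ t) :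
    (expVector ℓ r).map (fun x i => x i + t)
      ≤ ENNReal.ofReal (Real.exp (ℓ * r * t)) • expVector ℓ r := by
  have := isProbabilityMeasure_expMeasure hr
  have hfin : IsFiniteMeasure ((expMeasure r).map (· + t)) := inferInstance
  have h : (expVector ℓ r).map (fun x i => x i + t)
      = ENNReal.ofReal (Real.exp (ℓ * r * t)) •
        (expVector ℓ r).restrict (Set.univ.pi fun _ => Set.Ici t) := by
    rw [expVector, Measure.pi_map_pi (μ := fun _ : Fin ℓ => expMeasure r)
      (f := fun _ x => x + t) fun _ => by fun_prop]
    refine Measure.pi_eq fun s hs => ?_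
    rw [Measure.smul_apply, Measure.restrict_apply (MeasurableSet.univ_pi hs),
      ← Set.pi_inter_distrib, Measure.pi_pi]
    simp only [map_add_const_expMeasure r ht, Measure.smul_apply, smul_eq_mul,
      Finset.prod_mul_distrib, Finset.prod_const, Finset.card_univ, Fintype.card_fin]
    rw [← ENNReal.ofReal_pow (Real.exp_pos _).le, ← Real.exp_nat_mul, ← mul_assoc (ℓ : ℝ)]
    congr 1
    exact Finset.prod_congr rfl fun i _ => (Measure.restrict_apply (hs i)).symm
  rw [h]
  intro s
  simp only [Measure.smul_apply, smul_eq_mul]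
  gcongr
  exact Measure.restrict_le_self

lemma measurePreserving_comp_expVector {r : ℝ} (hr : 0 < r) (σ : Equiv.Perm (Fin ℓ)) :
    MeasurePreserving (fun x : Fin ℓ → ℝ => x ∘ σ) (expVector ℓ r) (expVector ℓ r) := by
  have := isProbabilityMeasure_expMeasure hr
  have hm : Measurable fun x : Fin ℓ → ℝ => x ∘ σ :=
    measurable_pi_lambda _ fun i => measurable_pi_apply (σ i)
  refine ⟨hm, ?_⟩
  refine (Measure.pi_eq fun s hs => ?_).symm
  rw [Measure.map_apply hm (MeasurableSet.univ_pi hs)]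
  have : (fun x : Fin ℓ → ℝ => x ∘ σ) ⁻¹' Set.univ.pi s
      = Set.univ.pi fun i => s (σ.symm i) := by
    ext x
    simp only [Set.mem_preimage, Set.mem_univ_pi, Function.comp_apply]
    exact ⟨fun h i => by simpa using h (σ.symm i), fun h i => by simpa using h (σ i)⟩
  rw [this, expVector, Measure.pi_pi]
  exact Equiv.prod_comp σ.symm fun i => expMeasure r (s i)

lemma measurable_lastTime_earliest (q : ℕ) (s : Finset (Fin ℓ)) :
    Measurable fun x : Fin ℓ → ℝ => lastTime (earliest q s x) x :=
  measurable_lastTime.comp ((measurable_earliest q s).prodMk measurable_id)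

/-- An upper bound for the mean of an order statistic of exponential times. -/
lemma lintegral_lastTime_earliest_le {r : ℝ} (hr : 0 < r) {γ : ℝ} (hγ : γ < 1) {q : ℕ}
    {s : Finset (Fin ℓ)} (hq : 0 < q) (hqs : q ≤ s.card) (hqγ : (q : ℝ) < γ * s.card + 1) :
    ∫⁻ x, ENNReal.ofReal (lastTime (earliest q s x) x) ∂(expVector ℓ r)
      ≤ ENNReal.ofReal (1 / (r * (1 - γ))) := by
  have hs : (0 : ℝ) < s.card := by exact_mod_cast hq.trans_le hqs
  have hD : 0 < (1 - γ) * s.card := mul_pos (by linarith) hs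
  -- The hypothesis `hqγ` gives `s.card - q + 1 > (1 - γ) * s.card`, which controls the order
  -- statistic by the average of the coordinates.
  have hle : ∀ᵐ x ∂(expVector ℓ r), ENNReal.ofReal (lastTime (earliest q s x) x)
      ≤ ENNReal.ofReal (1 / ((1 - γ) * s.card)) * ∑ i ∈ s, ENNReal.ofReal (x i) := by
    filter_upwards [ae_pos_expVector hr] with x hx
    rw [← ENNReal.ofReal_sum_of_nonneg fun i _ => (hx i).le, ← ENNReal.ofReal_mul (by positivity)]
    refine ENNReal.ofReal_le_ofReal ?_
    have h1 := mul_lastTime_earliest_le (fun i _ => (hx i).le) hq hqs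
    obtain ⟨i, -, hi⟩ := exists_lastTime_eq
      (Finset.card_pos.1 ((card_earliest x hqs).symm ▸ hq)) x
    have h2 : 0 < lastTime (earliest q s x) x := hi ▸ hx i
    rw [one_div_mul_eq_div, le_div_iff₀ hD]
    nlinarith
  refine (lintegral_mono_ae hle).trans ?_
  have hm : ∀ i ∈ s, Measurable fun x : Fin ℓ → ℝ => ENNReal.ofReal (x i) := fun i _ => by
    fun_prop
  rw [lintegral_const_mul _ (Finset.measurable_sum _ hm), lintegral_finsetSum _ hm]
  have hi : ∀ i ∈ s, ∫⁻ x, ENNReal.ofReal (x i) ∂(expVector ℓ r) = ENNReal.ofReal (1 / r) :=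
    fun i _ => by
      rw [← lintegral_ofReal_expMeasure hr, ← (measurePreserving_eval_expVector hr i).map_eq,
        lintegral_map (by fun_prop) (by fun_prop)]
  rw [Finset.sum_congr rfl hi, Finset.sum_const, nsmul_eq_mul, ← ENNReal.ofReal_natCast,
    ← ENNReal.ofReal_mul (by positivity), ← ENNReal.ofReal_mul (by positivity)]
  refine ENNReal.ofReal_le_ofReal (le_of_eq ?_)
  have : (1 - γ) ≠ 0 := by linarith
  field_simp

/-- An upper bound for the lower tail of an order statistic of exponential times. -/
lemma expVector_lastTime_earliest_lt_le {r : ℝ} (hr : 0 < r) {γ : ℝ} (hγ : 0 < γ) {q : ℕ}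
    {s : Finset (Fin ℓ)} (hq : 0 < q) (hqs : q ≤ s.card) (hqγ : γ * s.card ≤ q) :
    expVector ℓ r {x | lastTime (earliest q s x) x < γ / (4 * r)} ≤ ENNReal.ofReal (1 / 4) := by
  set t := γ / (4 * r) with ht
  have hms : ∀ i : Fin ℓ, MeasurableSet {x : Fin ℓ → ℝ | x i < t} := fun i =>
    measurableSet_lt (measurable_pi_apply i) measurable_const
  have hms' : MeasurableSet {x : Fin ℓ → ℝ | lastTime (earliest q s x) x < t} :=
    measurableSet_lt (measurable_lastTime_earliest q s) measurable_const
  -- Markov's inequality for the number of coordinates below `t`, which is at least `q` on this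
  -- event and has mean at most `s.card * (r * t)`. The choice of `t` makes that mean at most `q /
  -- 4`.
  have hle : (q : ℝ≥0∞) * expVector ℓ r {x | lastTime (earliest q s x) x < t}
      ≤ ∑ i ∈ s, expVector ℓ r {x | x i < t} := by
    rw [← lintegral_indicator_one hms', ← lintegral_const_mul _
      (measurable_one.indicator hms')]
    simp_rw [← lintegral_indicator_one (hms _)]
    rw [← lintegral_finsetSum _ fun i _ => measurable_one.indicator (hms i)]
    refine lintegral_mono fun x => ?_
    by_cases hx : lastTime (earliest q s x) x < t
    · have h1 := card_filter_lt_of_lastTime_lt hqs hx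
      have h2 : ∑ i ∈ s, {x : Fin ℓ → ℝ | x i < t}.indicator (1 : (Fin ℓ → ℝ) → ℝ≥0∞) x
          = ((s.filter fun i => x i < t).card : ℝ≥0∞) := by
        simp [Set.indicator_apply]
      rw [h2, Set.indicator_of_mem (by simpa using hx), Pi.one_apply, mul_one]
      exact Nat.cast_le.2 h1
    · rw [Set.indicator_of_notMem (by simpa using hx), mul_zero]
      exact zero_le
  have hi : ∀ i ∈ s, expVector ℓ r {x | x i < t} ≤ ENNReal.ofReal (r * t) := fun i _ => by
    have := (measurePreserving_eval_expVector hr i).measure_preimage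
      (measurableSet_Iio (a := t)).nullMeasurableSet
    exact this.le.trans (expMeasure_Iio_le hr t)
  have h3 := hle.trans (Finset.sum_le_sum hi)
  rw [Finset.sum_const, nsmul_eq_mul] at h3
  have hq0 : (q : ℝ≥0∞) ≠ 0 := by exact_mod_cast hq.ne'
  rw [← ENNReal.mul_le_mul_iff_right hq0 (ENNReal.natCast_ne_top q)]
  refine h3.trans ?_
  rw [← ENNReal.ofReal_natCast, ← ENNReal.ofReal_natCast, ← ENNReal.ofReal_mul (by positivity),
    ← ENNReal.ofReal_mul (by positivity)]
  refine ENNReal.ofReal_le_ofReal ?_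
  have : r * t = γ / 4 := by
    rw [ht]
    field_simp
  rw [this]
  linarith

end ExponentialVector

/-! ### Law of one cycle -/

section Cycle

variable {ℓ : ℕ}

/-- The law of the availability and uplink times of all clients of a cluster in one cycle. -/
noncomputable def cycleLaw (ℓ : ℕ) (lam mu : ℝ) : Measure ((Fin ℓ → ℝ) × (Fin ℓ → ℝ)) :=
  (expVector ℓ lam).prod (expVector ℓ mu)

/-- The law of the duration of a cycle. -/
noncomputable def durationLaw (ℓ m k : ℕ) (lam mu c : ℝ) : Measure ℝ :=
  (cycleLaw ℓ lam mu).map fun z => cycleDuration m k c z.1 z.2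

variable {lam mu : ℝ}

lemma isProbabilityMeasure_cycleLaw (hlam : 0 < lam) (hmu : 0 < mu) :
    IsProbabilityMeasure (cycleLaw ℓ lam mu) := by
  have := isProbabilityMeasure_expVector (ℓ := ℓ) hlam
  have := isProbabilityMeasure_expVector (ℓ := ℓ) hmu
  rw [cycleLaw]
  infer_instance

lemma isProbabilityMeasure_durationLaw (hlam : 0 < lam) (hmu : 0 < mu) {m k : ℕ} {c : ℝ} :
    IsProbabilityMeasure (durationLaw ℓ m k lam mu c) := by
  have := isProbabilityMeasure_cycleLaw (ℓ := ℓ) hlam hmu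
  exact Measure.isProbabilityMeasure_map (measurable_cycleDuration m k c).aemeasurable

lemma ae_cycleLaw_fst (hlam : 0 < lam) (hmu : 0 < mu) {p : (Fin ℓ → ℝ) → Prop}
    (h : ∀ᵐ a ∂(expVector ℓ lam), p a) : ∀ᵐ z ∂(cycleLaw ℓ lam mu), p z.1 := by
  have := isProbabilityMeasure_expVector (ℓ := ℓ) hlam
  have := isProbabilityMeasure_expVector (ℓ := ℓ) hmu
  exact Measure.quasiMeasurePreserving_fst.ae h

lemma ae_cycleLaw_snd (hlam : 0 < lam) (hmu : 0 < mu) {p : (Fin ℓ → ℝ) → Prop}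
    (h : ∀ᵐ u ∂(expVector ℓ mu), p u) : ∀ᵐ z ∂(cycleLaw ℓ lam mu), p z.2 := by
  have := isProbabilityMeasure_expVector (ℓ := ℓ) hlam
  have := isProbabilityMeasure_expVector (ℓ := ℓ) hmu
  exact Measure.quasiMeasurePreserving_snd.ae h

lemma ae_pos_cycleDuration (hlam : 0 < lam) (hmu : 0 < mu) {m k : ℕ} {c : ℝ} (hc : 0 ≤ c)
    (hk0 : 0 < k) (hk : k ≤ m) (hm : m ≤ ℓ) :
    ∀ᵐ z ∂(cycleLaw ℓ lam mu), 0 < cycleDuration m k c z.1 z.2 := by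
  filter_upwards [ae_cycleLaw_fst hlam hmu (ae_pos_expVector hlam),
    ae_cycleLaw_snd hlam hmu (ae_pos_expVector hmu)] with z h1 h2
  exact cycleDuration_pos hc hk0 hk hm h1 h2

lemma ae_pos_durationLaw (hlam : 0 < lam) (hmu : 0 < mu) {m k : ℕ} {c : ℝ} (hc : 0 ≤ c)
    (hk0 : 0 < k) (hk : k ≤ m) (hm : m ≤ ℓ) : ∀ᵐ x ∂(durationLaw ℓ m k lam mu c), 0 < x :=
  (ae_map_iff (measurable_cycleDuration m k c).aemeasurable measurableSet_Ioi).2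
    (ae_pos_cycleDuration hlam hmu hc hk0 hk hm)

lemma measurable_cycleDuration_left (m k : ℕ) (c : ℝ) (u : Fin ℓ → ℝ) :
    Measurable fun a : Fin ℓ → ℝ => cycleDuration m k c a u := by
  simpa only [Function.comp_def] using
    (measurable_cycleDuration (ℓ := ℓ) m k c).comp (measurable_prodMk_right (y := u))

/-- For fixed uplink times, the duration is translated by translating the availability vector alone.
This yields the domination hypothesis of the renewal part with `θ = ℓ * lam`. -/
lemma map_add_const_durationLaw_le (hlam : 0 < lam) (hmu : 0 < mu) {m k : ℕ} {c : ℝ}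
    (hm0 : 0 < m) (hm : m ≤ ℓ) (t : ℝ) (ht : 0 ≤ t) :
    (durationLaw ℓ m k lam mu c).map (· + t)
      ≤ ENNReal.ofReal (Real.exp (ℓ * lam * t)) • durationLaw ℓ m k lam mu c := by
  have := isProbabilityMeasure_expVector (ℓ := ℓ) hlam
  have := isProbabilityMeasure_expVector (ℓ := ℓ) hmu
  have hX := measurable_cycleDuration (ℓ := ℓ) m k c
  refine Measure.le_iff.2 fun s hs => ?_
  have hs' : MeasurableSet ((fun x : ℝ => x + t) ⁻¹' s) := measurable_add_const t hs
  rw [Measure.map_apply (measurable_add_const t) hs, Measure.smul_apply, durationLaw,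
    Measure.map_apply hX hs', Measure.map_apply hX hs, cycleLaw,
    Measure.prod_apply_symm (hX hs'), Measure.prod_apply_symm (hX hs), smul_eq_mul,
    ← lintegral_const_mul' _ _ ENNReal.ofReal_ne_top]
  refine lintegral_mono fun u => ?_
  have htr : Measurable fun (a : Fin ℓ → ℝ) i => a i + t :=
    measurable_pi_lambda _ fun i => by fun_prop
  have h := Measure.le_iff'.1 (map_add_const_expVector_le (ℓ := ℓ) hlam ht)
    ((fun a => cycleDuration m k c a u) ⁻¹' s)
  rw [Measure.map_apply htr (measurable_cycleDuration_left m k c u hs), Measure.smul_apply, smul_eq_mul] at h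
  refine le_trans (le_of_eq ?_) h
  congr 1
  ext a
  simp only [Set.mem_preimage, cycleDuration_add_const hm0 hm]

/-- Given the availability times, the set of recipients is a fixed set of size `m`, so the order
statistic bound for the uplink phase applies uniformly. -/
lemma lintegral_durationLaw_le (hlam : 0 < lam) (hmu : 0 < mu) {m k : ℕ} {c α β : ℝ}
    (hc : 0 ≤ c) (hα : α < 1) (hβ : β < 1) (hk0 : 0 < k) (hk : k ≤ m) (hm : m ≤ ℓ)
    (hmβ : (m : ℝ) < β * ℓ + 1) (hkα : (k : ℝ) < α * m + 1) :
    ∫⁻ x, ENNReal.ofReal x ∂(durationLaw ℓ m k lam mu c)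
      ≤ ENNReal.ofReal (1 / (lam * (1 - β)) + c + 1 / (mu * (1 - α))) := by
  have := isProbabilityMeasure_expVector (ℓ := ℓ) hlam
  have := isProbabilityMeasure_expVector (ℓ := ℓ) hmu
  have hX := measurable_cycleDuration (ℓ := ℓ) m k c
  have hm0 := hk0.trans_le hk
  rw [durationLaw, lintegral_map (by fun_prop) hX, cycleLaw,
    lintegral_prod _ (by fun_prop)]
  have h1 : ∀ a : Fin ℓ → ℝ, ∫⁻ u, ENNReal.ofReal (cycleDuration m k c a u) ∂(expVector ℓ mu)
      ≤ ENNReal.ofReal (lastTime (available m a) a)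
        + ENNReal.ofReal (c + 1 / (mu * (1 - α))) := by
    intro a
    calc ∫⁻ u, ENNReal.ofReal (cycleDuration m k c a u) ∂(expVector ℓ mu)
        ≤ ∫⁻ u, (ENNReal.ofReal (lastTime (available m a) a) + ENNReal.ofReal c
            + ENNReal.ofReal (lastTime (earliest k (available m a) u) u)) ∂(expVector ℓ mu) :=
          lintegral_mono fun u => ENNReal.ofReal_add_le.trans (by
            gcongr
            · exact ENNReal.ofReal_add_le
            · exact le_rfl)
      _ ≤ ENNReal.ofReal (lastTime (available m a) a) + ENNReal.ofReal c
            + ENNReal.ofReal (1 / (mu * (1 - α))) := by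
          rw [lintegral_add_left measurable_const]
          simp only [lintegral_const, measure_univ, mul_one]
          gcongr
          exact lintegral_lastTime_earliest_le hmu hα hk0 (by rwa [card_available hm])
            (by rwa [card_available hm])
      _ = _ := by
          rw [add_assoc, ENNReal.ofReal_add hc]
          have : 0 < 1 - α := by linarith
          positivity
  refine (lintegral_mono h1).trans ?_
  rw [lintegral_add_right _ measurable_const]
  simp only [lintegral_const, measure_univ, mul_one]
  have h2 := lintegral_lastTime_earliest_le hlam hβ (s := (Finset.univ : Finset (Fin ℓ))) hm0
    (by simpa using hm) (by simpa using hmβ)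
  refine (add_le_add_left h2 _).trans (le_of_eq ?_)
  have h3 : 0 < 1 - α := by linarith
  have h4 : 0 < 1 - β := by linarith
  rw [← ENNReal.ofReal_add (by positivity) (by positivity), add_assoc]

/-- A duration below the truncation level forces one of the two random phases below its own share of
it. Each has probability at most `1 / 4`, so the level is reached with probability at least `1 / 2`.
-/
lemma le_truncMean_durationLaw (hlam : 0 < lam) (hmu : 0 < mu) {m k : ℕ} {c α β : ℝ}
    (hc : 0 ≤ c) (hα : 0 < α) (hβ : 0 < β) (hk0 : 0 < k) (hk : k ≤ m) (hm : m ≤ ℓ)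
    (hmβ : β * ℓ ≤ m) (hkα : α * m ≤ k) :
    ENNReal.ofReal ((β / (4 * lam) + c + α / (4 * mu)) / 2)
      ≤ Renewal.truncMean (durationLaw ℓ m k lam mu c) (β / (4 * lam) + c + α / (4 * mu)) := by
  have := isProbabilityMeasure_expVector (ℓ := ℓ) hlam
  have := isProbabilityMeasure_expVector (ℓ := ℓ) hmu
  have := isProbabilityMeasure_durationLaw (ℓ := ℓ) (m := m) (k := k) (c := c) hlam hmu
  have hX := measurable_cycleDuration (ℓ := ℓ) m k c
  have hm0 := hk0.trans_le hk
  set b := β / (4 * lam) + c + α / (4 * mu) with hb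
  have hb0 : 0 < b := by positivity
  set F := durationLaw ℓ m k lam mu c with hF
  have h1 : F (Set.Iio b) ≤ ENNReal.ofReal (1 / 2) := by
    set s1 := {z : (Fin ℓ → ℝ) × (Fin ℓ → ℝ) | lastTime (available m z.1) z.1 < β / (4 * lam)}
    set s2 := {z : (Fin ℓ → ℝ) × (Fin ℓ → ℝ) |
      lastTime (aggregated m k z.1 z.2) z.2 < α / (4 * mu)} with hs2
    have hs2m : MeasurableSet s2 := measurableSet_lt
      (measurable_lastTime.comp ((measurable_aggregated m k).prodMk measurable_snd))
      measurable_const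
    have hsub : (fun z : (Fin ℓ → ℝ) × (Fin ℓ → ℝ) => cycleDuration m k c z.1 z.2) ⁻¹' Set.Iio b
        ⊆ s1 ∪ s2 := by
      intro z hz
      by_contra h
      simp only [s1, s2, Set.mem_union, Set.mem_ofPred_eq, not_or, not_lt] at h
      simp only [Set.mem_preimage, Set.mem_Iio, cycleDuration] at hz
      linarith [h.1, h.2]
    have e1 : cycleLaw ℓ lam mu s1 ≤ ENNReal.ofReal (1 / 4) := by
      have h := expVector_lastTime_earliest_lt_le hlam hβ
        (s := (Finset.univ : Finset (Fin ℓ))) hm0 (by simpa using hm) (by simpa using hmβ)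
      have hpre := (measurePreserving_fst (μ := expVector ℓ lam)
        (ν := expVector ℓ mu)).measure_preimage
          (measurableSet_lt (measurable_lastTime_earliest m Finset.univ)
            (measurable_const (a := β / (4 * lam)))).nullMeasurableSet
      exact hpre.le.trans h
    have e2 : cycleLaw ℓ lam mu s2 ≤ ENNReal.ofReal (1 / 4) := by
      rw [cycleLaw, Measure.prod_apply hs2m]
      calc _ ≤ ∫⁻ _, ENNReal.ofReal (1 / 4) ∂(expVector ℓ lam) := lintegral_mono fun a =>
            expVector_lastTime_earliest_lt_le hmu hα hk0 (by rwa [card_available hm])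
              (by rwa [card_available hm])
        _ = _ := by simp
    rw [hF, durationLaw, Measure.map_apply hX measurableSet_Iio]
    refine (measure_mono hsub).trans ((measure_union_le _ _).trans ((add_le_add e1 e2).trans ?_))
    rw [← ENNReal.ofReal_add (by norm_num) (by norm_num)]
    norm_num
  have h2 : ENNReal.ofReal (1 / 2) ≤ F (Set.Ici b) := by
    have h3 := prob_compl_eq_one_sub (μ := F) (measurableSet_Iio (a := b))
    rw [Set.compl_Iio] at h3
    rw [h3]
    refine le_trans (le_of_eq ?_) (tsub_le_tsub_left h1 1)
    rw [← ENNReal.ofReal_one, ← ENNReal.ofReal_sub _ (by norm_num)]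
    norm_num
  calc ENNReal.ofReal (b / 2) = ENNReal.ofReal b * ENNReal.ofReal (1 / 2) := by
        rw [← ENNReal.ofReal_mul hb0.le]
        congr 1
        ring
    _ ≤ ENNReal.ofReal b * F (Set.Ici b) := by gcongr
    _ = ∫⁻ x, (Set.Ici b).indicator (fun _ => ENNReal.ofReal b) x ∂F := by
        rw [lintegral_indicator_const measurableSet_Ici]
    _ ≤ _ := by
        refine lintegral_mono_ae ?_
        filter_upwards [ae_pos_durationLaw hlam hmu hc hk0 hk hm] with x hx
        refine Set.indicator_apply_le' (fun h => ?_) fun _ => bot_le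
        exact ENNReal.ofReal_le_ofReal (le_min h le_rfl : b ≤ min x b)

/-- A bound for the expected number of crossings which depends only on the two quotas. -/
lemma crossings_durationLaw_le (hlam : 0 < lam) (hmu : 0 < mu) {m k : ℕ} {c α β : ℝ}
    (hc : 0 ≤ c) (hα : α ∈ Set.Ioo (0 : ℝ) 1) (hβ : β ∈ Set.Ioo (0 : ℝ) 1)
    (hk0 : 0 < k) (hk : k ≤ m) (hm : m ≤ ℓ) (hmβ : β * ℓ ≤ m) (hkα : α * m ≤ k)
    (hmβ' : (m : ℝ) < β * ℓ + 1) (hkα' : (k : ℝ) < α * m + 1) (g : ℕ) :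
    Renewal.crossings (durationLaw ℓ m k lam mu c) g
      ≤ ENNReal.ofReal (2 * (4 / (β * (1 - β)) + 4 / (α * (1 - α)) + 2)) := by
  have := isProbabilityMeasure_durationLaw (ℓ := ℓ) (m := m) (k := k) (c := c) hlam hmu
  obtain ⟨hα0, hα1⟩ := hα
  obtain ⟨hβ0, hβ1⟩ := hβ
  have hα2 : 0 < 1 - α := by linarith
  have hβ2 : 0 < 1 - β := by linarith
  have hb0 : 0 < β / (4 * lam) + c + α / (4 * mu) := by positivity
  -- The truncation level has the three parts of the mean bound up to factors in `α` and `β`, so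
  -- `lam`, `mu` and `c` disappear from the ratio.
  refine (Renewal.crossings_le (ae_pos_durationLaw hlam hmu hc hk0 hk hm) hb0 g).trans ?_
  refine (ENNReal.div_le_div (add_le_add_left
    (lintegral_durationLaw_le hlam hmu hc hα1 hβ1 hk0 hk hm hmβ' hkα') _)
    (le_truncMean_durationLaw hlam hmu hc hα0 hβ0 hk0 hk hm hmβ hkα)).trans ?_
  rw [← ENNReal.ofReal_add (by positivity) hb0.le, ← ENNReal.ofReal_div_of_pos (by positivity)]
  refine ENNReal.ofReal_le_ofReal ?_
  rw [div_le_iff₀ (by positivity)]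
  have e1 : 1 / (lam * (1 - β)) = 4 / (β * (1 - β)) * (β / (4 * lam)) := by field_simp
  have e2 : 1 / (mu * (1 - α)) = 4 / (α * (1 - α)) * (α / (4 * mu)) := by field_simp
  rw [e1, e2]
  have p1 : 0 < 4 / (β * (1 - β)) := by positivity
  have p2 : 0 < 4 / (α * (1 - α)) := by positivity
  have p3 : 0 < β / (4 * lam) := by positivity
  have p4 : 0 < α / (4 * mu) := by positivity
  generalize 4 / (β * (1 - β)) = x at *
  generalize 4 / (α * (1 - α)) = y at *
  generalize β / (4 * lam) = z at *
  generalize α / (4 * mu) = w at *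
  nlinarith [mul_nonneg p1.le hc, mul_nonneg p1.le p4.le, mul_nonneg p2.le hc,
    mul_nonneg p2.le p3.le]

lemma measurePreserving_comp_cycleLaw (hlam : 0 < lam) (hmu : 0 < mu)
    (σ : Equiv.Perm (Fin ℓ)) :
    MeasurePreserving (Prod.map (fun a : Fin ℓ → ℝ => a ∘ σ) (fun u : Fin ℓ → ℝ => u ∘ σ))
      (cycleLaw ℓ lam mu) (cycleLaw ℓ lam mu) := by
  have := isProbabilityMeasure_expVector (ℓ := ℓ) hlam
  have := isProbabilityMeasure_expVector (ℓ := ℓ) hmu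
  exact (measurePreserving_comp_expVector hlam σ).prod (measurePreserving_comp_expVector hmu σ)

/-- Whether a client is aggregated is independent of the duration of the cycle. -/
lemma cycleLaw_mem_aggregated_inter (hlam : 0 < lam) (hmu : 0 < mu) {m k : ℕ} {c : ℝ}
    (hk0 : 0 < k) (hk : k ≤ m) (hm : m ≤ ℓ) (i : Fin ℓ) {s : Set ℝ} (hs : MeasurableSet s) :
    cycleLaw ℓ lam mu ({z | i ∈ aggregated m k z.1 z.2}
        ∩ (fun z => cycleDuration m k c z.1 z.2) ⁻¹' s)
      = (k : ℝ≥0∞) / ℓ * durationLaw ℓ m k lam mu c s := by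
  have hX := measurable_cycleDuration (ℓ := ℓ) m k c
  set E : Fin ℓ → Set ((Fin ℓ → ℝ) × (Fin ℓ → ℝ)) := fun i =>
    {z | i ∈ aggregated m k z.1 z.2} ∩ (fun z => cycleDuration m k c z.1 z.2) ⁻¹' s with hE
  have hEm : ∀ i, MeasurableSet (E i) := fun i =>
    (measurableSet_mem_aggregated m k i).inter (hX hs)
  -- Swapping `i` and `j` preserves the law and, off the null set of ties, carries one event to the
  -- other.
  have hsym : ∀ j, cycleLaw ℓ lam mu (E j) = cycleLaw ℓ lam mu (E i) := by
    intro j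
    rw [← (measurePreserving_comp_cycleLaw hlam hmu (Equiv.swap i j)).measure_preimage
      (hEm i).nullMeasurableSet]
    refine measure_congr ?_
    filter_upwards [ae_cycleLaw_fst hlam hmu (ae_injective_expVector hlam),
      ae_cycleLaw_snd hlam hmu (ae_injective_expVector hmu)] with z h1 h2
    refine propext ?_
    change z ∈ E j ↔ Prod.map _ _ z ∈ E i
    simp only [hE, Set.mem_inter_iff, Set.mem_preimage, Set.mem_ofPred_eq, Prod.map_fst,
      Prod.map_snd, mem_aggregated_comp h1 h2, cycleDuration_comp hk0 hk hm h1 h2,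
      Equiv.swap_apply_left]
  -- Every cycle aggregates exactly `k` clients, so the indicators of the `E j` add up to `k`
  -- whenever the duration lies in `s`.
  have hsum : ∑ j, cycleLaw ℓ lam mu (E j) = k * durationLaw ℓ m k lam mu c s := by
    rw [durationLaw, Measure.map_apply hX hs, ← lintegral_indicator_one (hX hs),
      ← lintegral_const_mul _ (measurable_one.indicator (hX hs))]
    simp_rw [← lintegral_indicator_one (hEm _)]
    rw [← lintegral_finsetSum _ fun j _ => measurable_one.indicator (hEm j)]
    refine lintegral_congr fun z => ?_
    have hZ : z ∈ (fun z : (Fin ℓ → ℝ) × (Fin ℓ → ℝ) => cycleDuration m k c z.1 z.2) ⁻¹' s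
        ↔ cycleDuration m k c z.1 z.2 ∈ s := Iff.rfl
    by_cases hz : cycleDuration m k c z.1 z.2 ∈ s
    · have h1 : ∀ j, (E j).indicator (1 : _ × _ → ℝ≥0∞) z
          = if j ∈ aggregated m k z.1 z.2 then 1 else 0 := fun j => by
        by_cases hj : j ∈ aggregated m k z.1 z.2
        · rw [if_pos hj, Set.indicator_of_mem (show z ∈ E j from ⟨hj, hz⟩), Pi.one_apply]
        · rw [if_neg hj, Set.indicator_of_notMem fun h => hj h.1]
      rw [Finset.sum_congr rfl fun j _ => h1 j, Set.indicator_of_mem (hZ.2 hz)]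
      simp [card_aggregated hk hm]
    · rw [Finset.sum_eq_zero fun j _ => Set.indicator_of_notMem (fun h => hz h.2) _,
        Set.indicator_of_notMem (fun h => hz (hZ.1 h)), mul_zero]
  rw [Finset.sum_congr rfl fun j _ => hsym j, Finset.sum_const, Finset.card_univ,
    Fintype.card_fin, nsmul_eq_mul] at hsum
  have hℓ : (ℓ : ℝ≥0∞) ≠ 0 := by exact_mod_cast (hk0.trans_le (hk.trans hm)).ne'
  rw [← ENNReal.mul_div_right_comm, ENNReal.eq_div_iff hℓ (ENNReal.natCast_ne_top ℓ)]
  exact hsum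

end Cycle

/-! ### Pathwise bound for the staleness -/

section Path

variable {e ℓ : ℕ}

/-- The time at which edge server `s` starts its cycle number `n`. -/
noncomputable def startTime (m k : ℕ) (c : ℝ) (a u : Fin e → ℕ → Fin ℓ → ℝ) (s : Fin e)
    (n : ℕ) : ℝ :=
  ∑ q ∈ Finset.range n, cycleDuration m k c (a s q) (u s q)

/-- Number of participations of client `i` of cluster `s` in the cycles before number `n`. -/
noncomputable def participations (m k : ℕ) (a u : Fin e → ℕ → Fin ℓ → ℝ) (s : Fin e) (i : Fin ℓ) (n : ℕ) : ℕ :=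
  Nat.count (fun r => i ∈ aggregated m k (a s r) (u s r)) n

open Classical in
/-- The number of cycles completed by all servers between two consecutive participations of a
client; the cycles of the other servers are sorted according to the cycle of server `s` during which
they end. -/
noncomputable def completionsBetween (m k : ℕ) (c : ℝ) (a u : Fin e → ℕ → Fin ℓ → ℝ) (s : Fin e)
    (i : Fin ℓ) (j : ℕ) : ℝ≥0∞ :=
  ∑' x : Fin e × ℕ, if x.1 = s then
      if participations m k a u s i x.2 = j ∧ i ∉ aggregated m k (a s x.2) (u s x.2)
        then 1 else 0
    else ∑' g, if participations m k a u s i g = j ∧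
        startTime m k c a u s g < startTime m k c a u x.1 (x.2 + 1) ∧
        startTime m k c a u x.1 (x.2 + 1) ≤ startTime m k c a u s (g + 1) then 1 else 0

variable {m k : ℕ} {c : ℝ} {a u : Fin e → ℕ → Fin ℓ → ℝ} {s : Fin e} {i : Fin ℓ}

lemma strictMono_startTime (hpos : ∀ s r, 0 < cycleDuration m k c (a s r) (u s r)) (s : Fin e) :
    StrictMono (startTime m k c a u s) :=
  strictMono_nat_of_lt_succ fun n => by
    simp only [startTime, Finset.sum_range_succ]
    linarith [hpos s n]

lemma startTime_zero (s : Fin e) : startTime m k c a u s 0 = 0 := by simp [startTime]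

lemma strictMono_updateTime (hpos : ∀ s r, 0 < cycleDuration m k c (a s r) (u s r))
    (hinf : {r | i ∈ aggregated m k (a s r) (u s r)}.Infinite) :
    StrictMono (updateTime m k c a u s i) := by
  have hS := strictMono_startTime hpos s
  refine strictMono_nat_of_lt_succ fun n => ?_
  cases n with
  | zero => exact (startTime_zero s).symm.trans_lt (hS (Nat.succ_pos _))
  | succ n => exact hS (Nat.succ_lt_succ (Nat.nth_strictMono hinf (Nat.lt_succ_self n)))

lemma updateCount_eq (hpos : ∀ s r, 0 < cycleDuration m k c (a s r) (u s r))
    (hinf : {r | i ∈ aggregated m k (a s r) (u s r)}.Infinite) {j : ℕ} {τ : ℝ}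
    (h1 : updateTime m k c a u s i j ≤ τ) (h2 : τ < updateTime m k c a u s i (j + 1)) :
    updateCount m k c a u s i τ = j := by
  have hT := strictMono_updateTime hpos hinf
  have : {j : ℕ | 1 ≤ j ∧ updateTime m k c a u s i j ≤ τ} = Finset.Icc 1 j := by
    ext q
    simp only [Set.mem_ofPred_eq, Finset.coe_Icc, Set.mem_Icc, and_congr_right_iff]
    refine fun _ => ⟨fun h => ?_, fun h => (hT.monotone h).trans h1⟩
    exact Nat.lt_succ_iff.1 (hT.lt_iff_lt.1 (h.trans_lt h2))
  rw [updateCount, this, Set.ncard_coe_finset]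
  simp

/-- The pairs (server, cycle) completed strictly between two consecutive participations. -/
def completedBetween (m k : ℕ) (c : ℝ) (a u : Fin e → ℕ → Fin ℓ → ℝ) (s : Fin e) (i : Fin ℓ)
    (j : ℕ) : Set (Fin e × ℕ) :=
  {x | updateTime m k c a u s i j < completionTime m k c a u x.1 x.2 ∧
    completionTime m k c a u x.1 x.2 < updateTime m k c a u s i (j + 1)}

lemma finite_completed (hfin : ∀ (s : Fin e) (t : ℝ), {r | completionTime m k c a u s r ≤ t}.Finite)
    (t : ℝ) : {x : Fin e × ℕ | completionTime m k c a u x.1 x.2 ≤ t}.Finite := by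
  have : {x : Fin e × ℕ | completionTime m k c a u x.1 x.2 ≤ t}
      = ⋃ s : Fin e, Prod.mk s '' {r | completionTime m k c a u s r ≤ t} := by
    ext ⟨s, r⟩
    simp
  rw [this]
  exact Set.finite_iUnion fun s => (hfin s t).image _

lemma finite_completedBetween
    (hfin : ∀ (s : Fin e) (t : ℝ), {r | completionTime m k c a u s r ≤ t}.Finite) (j : ℕ) :
    (completedBetween m k c a u s i j).Finite :=
  (finite_completed hfin _).subset fun _ hx => hx.2.le

/-- Between the two participations the client keeps the cloud version of the earlier one (of time
`0` when `j = 0`), so the gap counts completions since then. As `ℤ` is discrete, a left limit is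
attained at some earlier time in this interval. -/
lemma staleness_le_ncard (hpos : ∀ s r, 0 < cycleDuration m k c (a s r) (u s r))
    (hfin : ∀ (s : Fin e) (t : ℝ), {r | completionTime m k c a u s r ≤ t}.Finite)
    (hinf : {r | i ∈ aggregated m k (a s r) (u s r)}.Infinite) (j : ℕ) :
    staleness m k c a u s i (j + 1) ≤ (completedBetween m k c a u s i j).ncard := by
  have hT := strictMono_updateTime hpos hinf
  set t := updateTime m k c a u s i (j + 1) with ht
  rw [staleness, ← ht]
  by_cases hlim : ∃ y, Tendsto (versionGap m k c a u s i) (𝓝[<] t) (𝓝 y)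
  · have h1 := tendsto_leftLim_of_tendsto hlim
    rw [nhds_discrete, tendsto_pure] at h1
    have h2 : ∀ᶠ τ in 𝓝[<] t, τ ∈ Set.Ioo (updateTime m k c a u s i j) t :=
      Ioo_mem_nhdsLT (hT (Nat.lt_succ_self j))
    obtain ⟨τ, hτ, hτ1, hτ2⟩ := (h1.and h2).exists
    rw [← hτ, versionGap, clientVersion, updateCount_eq hpos hinf hτ1.le hτ2, sub_le_iff_le_add]
    have hsub : {x : Fin e × ℕ | completionTime m k c a u x.1 x.2 ≤ τ}
        ⊆ completedBetween m k c a u s i j ∪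
          {x | completionTime m k c a u x.1 x.2 ≤ updateTime m k c a u s i j} := by
      intro x hx
      by_cases h : completionTime m k c a u x.1 x.2 ≤ updateTime m k c a u s i j
      · exact Or.inr h
      · exact Or.inl ⟨not_le.1 h, lt_of_le_of_lt hx hτ2⟩
    have h3 := (Set.ncard_le_ncard hsub ((finite_completedBetween hfin j).union
      (finite_completed hfin _))).trans (Set.ncard_union_le _ _)
    exact_mod_cast h3
  -- Without a left limit, `Function.leftLim` defaults to the value at `t`, where the client has
  -- just been updated and the gap is `0`.
  · rw [leftLim_eq_of_not_tendsto _ hlim, versionGap, clientVersion,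
      updateCount_eq hpos hinf le_rfl (hT (Nat.lt_succ_self (j + 1))), ← ht, sub_self]
    positivity

/-- `Nat.nth` counts from `0`: `h2` places the cycle no later than that of participation `j + 1`,
and `h1` places it after that of participation `j`. -/
lemma participations_eq (hpos : ∀ s r, 0 < cycleDuration m k c (a s r) (u s r))
    (hinf : {r | i ∈ aggregated m k (a s r) (u s r)}.Infinite) {j g : ℕ}
    (h1 : updateTime m k c a u s i j < startTime m k c a u s (g + 1))
    (h2 : g ≤ Nat.nth (fun r => i ∈ aggregated m k (a s r) (u s r)) j) :
    participations m k a u s i g = j := by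
  refine le_antisymm ((Nat.count_le_iff_le_nth hinf).2 h2) ?_
  cases j with
  | zero => exact Nat.zero_le _
  | succ j =>
    have h3 := (strictMono_startTime hpos s).lt_iff_lt.1 (show startTime m k c a u s _ < _ from h1)
    exact (Nat.lt_nth_iff_count_lt hinf).2 (Nat.succ_lt_succ_iff.1 h3)

lemma ncard_completedBetween_le (hpos : ∀ s r, 0 < cycleDuration m k c (a s r) (u s r))
    (hfin : ∀ (s : Fin e) (t : ℝ), {r | completionTime m k c a u s r ≤ t}.Finite)
    (hinf : {r | i ∈ aggregated m k (a s r) (u s r)}.Infinite) (j : ℕ) :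
    ((completedBetween m k c a u s i j).ncard : ℝ≥0∞) ≤ completionsBetween m k c a u s i j := by
  have hG := finite_completedBetween (s := s) (i := i) hfin j
  have hS := strictMono_startTime hpos s
  rw [Set.ncard_eq_toFinset_card _ hG, Finset.card_eq_sum_ones, Nat.cast_sum]
  refine (Finset.sum_le_sum fun x hx => ?_).trans (ENNReal.sum_le_tsum hG.toFinset)
  obtain ⟨s', r⟩ := x
  obtain ⟨h1, h2⟩ := hG.mem_toFinset.1 hx
  simp only [Nat.cast_one]
  by_cases hs : s' = s
  · subst hs
    have h3 : r < Nat.nth (fun r => i ∈ aggregated m k (a s' r) (u s' r)) j :=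
      Nat.succ_lt_succ_iff.1 (hS.lt_iff_lt.1 h2)
    have h4 := participations_eq hpos hinf h1 h3.le
    have h5 : i ∉ aggregated m k (a s' r) (u s' r) := fun h => h3.ne (by
      rw [← h4]
      exact (Nat.nth_count (p := fun r => i ∈ aggregated m k (a s' r) (u s' r)) h).symm)
    rw [if_pos rfl, if_pos ⟨h4, h5⟩]
  · rw [if_neg hs]
    classical
    -- The least such `g` is the cycle of `s` to which the foreign completion is charged. It may be
    -- the cycle of participation `j + 1` itself, whose preceding count is still `j`.
    have hex : ∃ g, startTime m k c a u s' (r + 1) ≤ startTime m k c a u s (g + 1) :=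
      ⟨_, le_of_lt h2⟩
    have hg1 := Nat.find_spec hex
    have hg2 : Nat.find hex ≤ Nat.nth (fun r => i ∈ aggregated m k (a s r) (u s r)) j :=
      Nat.find_min' hex (le_of_lt h2)
    have hg3 : startTime m k c a u s (Nat.find hex) < startTime m k c a u s' (r + 1) := by
      rcases h : Nat.find hex with _ | g
      · rw [startTime_zero, ← startTime_zero (m := m) (k := k) (c := c) (a := a) (u := u) s']
        exact strictMono_startTime hpos s' (Nat.succ_pos r)
      · exact not_le.1 (Nat.find_min hex (h ▸ Nat.lt_succ_self g))
    refine le_trans (le_of_eq ?_) (ENNReal.le_tsum (Nat.find hex))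
    rw [if_pos ⟨participations_eq hpos hinf (lt_of_lt_of_le h1 hg1) hg2, hg3, hg1⟩]

/-- A pathwise bound for the staleness. -/
lemma staleness_le_completionsBetween
    (hpos : ∀ s r, 0 < cycleDuration m k c (a s r) (u s r))
    (hfin : ∀ (s : Fin e) (t : ℝ), {r | completionTime m k c a u s r ≤ t}.Finite)
    (hinf : {r | i ∈ aggregated m k (a s r) (u s r)}.Infinite) (j : ℕ) :
    ((staleness m k c a u s i (j + 1)).toNat : ℝ≥0∞) ≤ completionsBetween m k c a u s i j := by
  refine le_trans ?_ (ncard_completedBetween_le hpos hfin hinf j)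
  have := staleness_le_ncard hpos hfin hinf j
  exact Nat.cast_le.2 (by omega)

end Path

/-! ### Independent cycles as random variables -/

section Probability

variable {e ℓ : ℕ} {Ω : Type*} {Z : Fin e → ℕ → Ω → (Fin ℓ → ℝ) × (Fin ℓ → ℝ)}

/-- The information contained in a set of cycles. -/
abbrev cycleSigma (Z : Fin e → ℕ → Ω → (Fin ℓ → ℝ) × (Fin ℓ → ℝ)) (T : Set (Fin e × ℕ)) :
    MeasurableSpace Ω :=
  ⨆ x ∈ T, MeasurableSpace.comap (Z x.1 x.2) inferInstance

lemma measurable_cycleSigma {T : Set (Fin e × ℕ)} {s : Fin e} {r : ℕ} (h : (s, r) ∈ T) :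
    Measurable[cycleSigma Z T] (Z s r) :=
  Measurable.mono (comap_measurable _)
    (le_iSup₂ (f := fun (x : Fin e × ℕ) (_ : x ∈ T) =>
      MeasurableSpace.comap (Z x.1 x.2) inferInstance) (s, r) h) le_rfl

variable {m k : ℕ} {c : ℝ}

/-- The start of a cycle as a random variable. -/
noncomputable def startRV (m k : ℕ) (c : ℝ) (Z : Fin e → ℕ → Ω → (Fin ℓ → ℝ) × (Fin ℓ → ℝ))
    (s : Fin e) (n : ℕ) (ω : Ω) : ℝ :=
  startTime m k c (fun s r => (Z s r ω).1) (fun s r => (Z s r ω).2) s n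

/-- The number of participations as a random variable. -/
noncomputable def participationsRV (m k : ℕ) (Z : Fin e → ℕ → Ω → (Fin ℓ → ℝ) × (Fin ℓ → ℝ))
    (s : Fin e) (i : Fin ℓ) (n : ℕ) (ω : Ω) : ℕ :=
  participations m k (fun s r => (Z s r ω).1) (fun s r => (Z s r ω).2) s i n

lemma startRV_succ (s : Fin e) (n : ℕ) (ω : Ω) : startRV m k c Z s (n + 1) ω
    = startRV m k c Z s n ω + cycleDuration m k c (Z s n ω).1 (Z s n ω).2 :=
  Finset.sum_range_succ _ _

lemma participationsRV_succ (s : Fin e) (i : Fin ℓ) (n : ℕ) (ω : Ω) :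
    participationsRV m k Z s i (n + 1) ω = participationsRV m k Z s i n ω
      + if i ∈ aggregated m k (Z s n ω).1 (Z s n ω).2 then 1 else 0 :=
  Nat.count_succ (fun r => i ∈ aggregated m k (Z s r ω).1 (Z s r ω).2) n

lemma measurable_startRV_cycleSigma {T : Set (Fin e × ℕ)} {s : Fin e} {n : ℕ}
    (hT : ∀ q < n, (s, q) ∈ T) : Measurable[cycleSigma Z T] (startRV m k c Z s n) := by
  induction n with
  | zero =>
    have : startRV m k c Z s 0 = fun _ => 0 := funext fun ω => startTime_zero s
    rw [this]
    exact measurable_const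
  | succ n ih =>
    have : startRV m k c Z s (n + 1)
        = fun ω => startRV m k c Z s n ω + cycleDuration m k c (Z s n ω).1 (Z s n ω).2 :=
      funext (startRV_succ s n)
    rw [this]
    exact (ih fun q hq => hT q (hq.trans (Nat.lt_succ_self n))).add
      ((measurable_cycleDuration m k c).comp (measurable_cycleSigma (hT n (Nat.lt_succ_self n))))

lemma measurable_participationsRV_cycleSigma {T : Set (Fin e × ℕ)} {s : Fin e} {i : Fin ℓ}
    {n : ℕ} (hT : ∀ q < n, (s, q) ∈ T) :
    Measurable[cycleSigma Z T] (participationsRV m k Z s i n) := by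
  induction n with
  | zero =>
    have : participationsRV m k Z s i 0 = fun _ => 0 := funext fun ω =>
      Nat.count_zero (fun r => i ∈ aggregated m k (Z s r ω).1 (Z s r ω).2)
    rw [this]
    exact measurable_const
  | succ n ih =>
    have : participationsRV m k Z s i (n + 1) = fun ω => participationsRV m k Z s i n ω
        + if i ∈ aggregated m k (Z s n ω).1 (Z s n ω).2 then 1 else 0 :=
      funext (participationsRV_succ s i n)
    rw [this]
    refine (ih fun q hq => hT q (hq.trans (Nat.lt_succ_self n))).add ?_
    exact Measurable.ite (measurable_cycleSigma (hT n (Nat.lt_succ_self n))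
      (measurableSet_mem_aggregated m k i)) measurable_const measurable_const

variable [MeasurableSpace Ω] {P : Measure Ω} {lam mu : ℝ}

/-- The availability and uplink times of the cycles are measurable, independent over all servers and
cycles, and follow the law of a cycle. -/
structure IndepCycles (P : Measure Ω) (lam mu : ℝ)
    (Z : Fin e → ℕ → Ω → (Fin ℓ → ℝ) × (Fin ℓ → ℝ)) : Prop where
  measurable : ∀ s r, Measurable (Z s r)
  law : ∀ s r, P.map (Z s r) = cycleLaw ℓ lam mu
  indep : iIndepFun (fun x : Fin e × ℕ => Z x.1 x.2) P

lemma IndepCycles.indepFun (hZ : IndepCycles P lam mu Z) {T T' : Set (Fin e × ℕ)}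
    (hT : Disjoint T T') {β γ : Type*} [MeasurableSpace β] [MeasurableSpace γ] {f : Ω → β}
    {g : Ω → γ} (hf : Measurable[cycleSigma Z T] f) (hg : Measurable[cycleSigma Z T'] g) :
    IndepFun f g P := by
  have h : Indep (cycleSigma Z T) (cycleSigma Z T') P :=
    indep_iSup_of_disjoint (m := fun x : Fin e × ℕ => MeasurableSpace.comap (Z x.1 x.2) inferInstance)
      (fun x => (hZ.measurable x.1 x.2).comap_le) hZ.indep.iIndep hT
  rw [IndepFun_iff_Indep]
  exact indep_of_indep_of_le_left (indep_of_indep_of_le_right h hg.comap_le) hf.comap_le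

lemma IndepCycles.cycleSigma_le (hZ : IndepCycles P lam mu Z) (T : Set (Fin e × ℕ)) :
    cycleSigma Z T ≤ ‹MeasurableSpace Ω› :=
  iSup₂_le fun x _ => (hZ.measurable x.1 x.2).comap_le

lemma IndepCycles.measurable_startRV (hZ : IndepCycles P lam mu Z) (s : Fin e) (n : ℕ) :
    Measurable (startRV m k c Z s n) :=
  (measurable_startRV_cycleSigma (T := Set.univ) fun _ _ => trivial).mono
    (hZ.cycleSigma_le _) le_rfl

lemma IndepCycles.measurable_participationsRV (hZ : IndepCycles P lam mu Z) (s : Fin e)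
    (i : Fin ℓ) (n : ℕ) : Measurable (participationsRV m k Z s i n) :=
  (measurable_participationsRV_cycleSigma (T := Set.univ) fun _ _ => trivial).mono
    (hZ.cycleSigma_le _) le_rfl

lemma disjoint_past_present (s : Fin e) (n : ℕ) :
    Disjoint {x : Fin e × ℕ | x.1 = s ∧ x.2 < n} {(s, n)} := by
  rw [Set.disjoint_singleton_right]
  exact fun h => lt_irrefl n h.2

lemma disjoint_servers {s s' : Fin e} (h : s' ≠ s) :
    Disjoint {x : Fin e × ℕ | x.1 = s} {x | x.1 = s'} :=
  Set.disjoint_left.2 fun _ hx hx' => h (hx'.symm.trans hx)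

/-- The past of a server is independent of its present cycle. -/
lemma IndepCycles.indepFun_past (hZ : IndepCycles P lam mu Z) (s : Fin e) (i : Fin ℓ) (n : ℕ) :
    IndepFun (fun ω => (participationsRV m k Z s i n ω, startRV m k c Z s n ω)) (Z s n) P :=
  hZ.indepFun (disjoint_past_present s n)
    ((measurable_participationsRV_cycleSigma (T := {x | x.1 = s ∧ x.2 < n})
        fun _ hq => ⟨rfl, hq⟩).prodMk
      (measurable_startRV_cycleSigma (T := {x | x.1 = s ∧ x.2 < n}) fun _ hq => ⟨rfl, hq⟩))
    (measurable_cycleSigma (T := {(s, n)}) rfl)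

variable [IsProbabilityMeasure P]

lemma IndepCycles.map_startRV (hZ : IndepCycles P lam mu Z) (hlam : 0 < lam) (hmu : 0 < mu)
    (s : Fin e) (n : ℕ) :
    P.map (startRV m k c Z s n) = Renewal.walkLaw (durationLaw ℓ m k lam mu c) n := by
  have := isProbabilityMeasure_durationLaw (ℓ := ℓ) (m := m) (k := k) (c := c) hlam hmu
  induction n with
  | zero =>
    have : startRV m k c Z s 0 = fun _ => 0 := funext fun ω => startTime_zero s
    rw [this, Measure.map_const, measure_univ, one_smul, Renewal.walkLaw]
  | succ n ih =>
    have h : startRV m k c Z s (n + 1)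
        = startRV m k c Z s n + fun ω => cycleDuration m k c (Z s n ω).1 (Z s n ω).2 :=
      funext (startRV_succ s n)
    have hX := (measurable_cycleDuration (ℓ := ℓ) m k c)
    have hXm : Measurable fun ω => cycleDuration m k c (Z s n ω).1 (Z s n ω).2 :=
      hX.comp (hZ.measurable s n)
    have hind : IndepFun (startRV m k c Z s n)
        (fun ω => cycleDuration m k c (Z s n ω).1 (Z s n ω).2) P :=
      hZ.indepFun (disjoint_past_present s n)
        (measurable_startRV_cycleSigma (T := {x | x.1 = s ∧ x.2 < n}) fun _ hq => ⟨rfl, hq⟩)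
        (hX.comp (measurable_cycleSigma (T := {(s, n)}) rfl))
    have hmap : P.map (fun ω => cycleDuration m k c (Z s n ω).1 (Z s n ω).2)
        = durationLaw ℓ m k lam mu c := by
      rw [durationLaw, ← hZ.law s n, Measure.map_map hX (hZ.measurable s n)]
      rfl
    rw [h, hind.map_add_eq_map_conv_map (hZ.measurable_startRV s n) hXm, ih, hmap, Renewal.walkLaw]

end Probability

/-! ### Independence of participation counts and timing -/

section Joint

/-- The hypotheses make the joint law a product of four laws, which may be regrouped by Tonelli. -/
lemma _root_.ProbabilityTheory.IndepFun.prodMk_comm {Ω α β γ δ : Type*} [MeasurableSpace Ω]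
    [MeasurableSpace α] [MeasurableSpace β] [MeasurableSpace γ] [MeasurableSpace δ]
    {P : Measure Ω} [IsProbabilityMeasure P] {A : Ω → α} {B : Ω → β} {C : Ω → γ} {D : Ω → δ}
    (hA : Measurable A) (hB : Measurable B) (hC : Measurable C) (hD : Measurable D)
    (hAB : IndepFun A B P) (hCD : IndepFun C D P)
    (h : IndepFun (fun ω => (A ω, B ω)) (fun ω => (C ω, D ω)) P) :
    IndepFun (fun ω => (A ω, C ω)) (fun ω => (B ω, D ω)) P := by
  have iA := Measure.isProbabilityMeasure_map (μ := P) hA.aemeasurable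
  have iB := Measure.isProbabilityMeasure_map (μ := P) hB.aemeasurable
  have iC := Measure.isProbabilityMeasure_map (μ := P) hC.aemeasurable
  have iD := Measure.isProbabilityMeasure_map (μ := P) hD.aemeasurable
  have hAC : IndepFun A C P := h.comp measurable_fst measurable_fst
  have hBD : IndepFun B D P := h.comp measurable_snd measurable_snd
  rw [indepFun_iff_map_prod_eq_prod_map_map (by fun_prop) (by fun_prop)] at h hAB hCD hAC hBD
  rw [indepFun_iff_measure_inter_preimage_eq_mul]
  intro a b ha hb
  have e1 : P ((fun ω => (A ω, C ω)) ⁻¹' a ∩ (fun ω => (B ω, D ω)) ⁻¹' b)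
      = P.map (fun ω => ((A ω, B ω), (C ω, D ω)))
        ((fun w : (α × β) × (γ × δ) => (w.1.1, w.2.1)) ⁻¹' a
          ∩ (fun w : (α × β) × (γ × δ) => (w.1.2, w.2.2)) ⁻¹' b) := by
    rw [Measure.map_apply (by fun_prop)
      (((by fun_prop : Measurable fun w : (α × β) × (γ × δ) => (w.1.1, w.2.1)) ha).inter
      ((by fun_prop : Measurable fun w : (α × β) × (γ × δ) => (w.1.2, w.2.2)) hb))]
    rfl
  have e2 : P ((fun ω => (A ω, C ω)) ⁻¹' a) = P.map (fun ω => (A ω, C ω)) a := by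
    rw [Measure.map_apply (by fun_prop) ha]
  have e3 : P ((fun ω => (B ω, D ω)) ⁻¹' b) = P.map (fun ω => (B ω, D ω)) b := by
    rw [Measure.map_apply (by fun_prop) hb]
  rw [e1, e2, e3, h, hAB, hCD, hAC, hBD, Measure.prod_apply
    (((by fun_prop : Measurable fun w : (α × β) × (γ × δ) => (w.1.1, w.2.1)) ha).inter
      ((by fun_prop : Measurable fun w : (α × β) × (γ × δ) => (w.1.2, w.2.2)) hb)),
    Measure.prod_apply ha, Measure.prod_apply hb,
    ← lintegral_prod_mul (measurable_measure_prodMk_left ha).aemeasurable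
      (measurable_measure_prodMk_left hb).aemeasurable]
  refine lintegral_congr fun x => ?_
  rw [← Measure.prod_prod]
  rfl

variable {e ℓ : ℕ} {Ω : Type*} [MeasurableSpace Ω] {P : Measure Ω}
  {lam mu : ℝ} {Z : Fin e → ℕ → Ω → (Fin ℓ → ℝ) × (Fin ℓ → ℝ)} {m k : ℕ} {c : ℝ}

/-- The duration of a cycle as a random variable. -/
noncomputable def durationRV (m k : ℕ) (c : ℝ) (Z : Fin e → ℕ → Ω → (Fin ℓ → ℝ) × (Fin ℓ → ℝ))
    (s : Fin e) (n : ℕ) (ω : Ω) : ℝ := cycleDuration m k c (Z s n ω).1 (Z s n ω).2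

lemma IndepCycles.measurable_durationRV (hZ : IndepCycles P lam mu Z) (s : Fin e) (n : ℕ) :
    Measurable (durationRV m k c Z s n) :=
  (measurable_cycleDuration m k c).comp (hZ.measurable s n)

lemma IndepCycles.map_durationRV (hZ : IndepCycles P lam mu Z) (s : Fin e) (n : ℕ) :
    P.map (durationRV m k c Z s n) = durationLaw ℓ m k lam mu c := by
  rw [durationLaw, ← hZ.law s n,
    Measure.map_map (measurable_cycleDuration m k c) (hZ.measurable s n)]
  rfl

/-- The indicator that a client participates in a cycle. -/
noncomputable def participatesRV (m k : ℕ) (Z : Fin e → ℕ → Ω → (Fin ℓ → ℝ) × (Fin ℓ → ℝ))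
    (s : Fin e) (i : Fin ℓ) (n : ℕ) (ω : Ω) : ℕ :=
  if i ∈ aggregated m k (Z s n ω).1 (Z s n ω).2 then 1 else 0

lemma measurable_ite_mem_aggregated (m k : ℕ) (i : Fin ℓ) :
    Measurable fun z : (Fin ℓ → ℝ) × (Fin ℓ → ℝ) => if i ∈ aggregated m k z.1 z.2 then 1 else 0 :=
  Measurable.ite (measurableSet_mem_aggregated m k i) measurable_const measurable_const

lemma IndepCycles.measurable_participatesRV (hZ : IndepCycles P lam mu Z) (s : Fin e) (i : Fin ℓ)
    (n : ℕ) : Measurable (participatesRV m k Z s i n) :=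
  (measurable_ite_mem_aggregated m k i).comp (hZ.measurable s n)

lemma IndepCycles.measure_participates_inter (hZ : IndepCycles P lam mu Z) (hlam : 0 < lam)
    (hmu : 0 < mu) (hk0 : 0 < k) (hk : k ≤ m) (hm : m ≤ ℓ) (s : Fin e) (i : Fin ℓ) (n : ℕ)
    {t : Set ℝ} (ht : MeasurableSet t) :
    P (participatesRV m k Z s i n ⁻¹' {1} ∩ durationRV m k c Z s n ⁻¹' t)
      = (k : ℝ≥0∞) / ℓ * durationLaw ℓ m k lam mu c t := by
  rw [← cycleLaw_mem_aggregated_inter hlam hmu hk0 hk hm i ht, ← hZ.law s n,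
    Measure.map_apply (hZ.measurable s n) ((measurableSet_mem_aggregated m k i).inter
      (measurable_cycleDuration m k c ht))]
  congr 1
  ext ω
  simp [participatesRV, durationRV]

lemma IndepCycles.measure_participates (hZ : IndepCycles P lam mu Z) (hlam : 0 < lam)
    (hmu : 0 < mu) (hk0 : 0 < k) (hk : k ≤ m) (hm : m ≤ ℓ) (s : Fin e) (i : Fin ℓ) (n : ℕ) :
    P (participatesRV m k Z s i n ⁻¹' {1}) = (k : ℝ≥0∞) / ℓ := by
  have := isProbabilityMeasure_durationLaw (ℓ := ℓ) (m := m) (k := k) (c := 0) hlam hmu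
  simpa using hZ.measure_participates_inter (c := 0) hlam hmu hk0 hk hm s i n MeasurableSet.univ

variable [IsProbabilityMeasure P]

/-- Participation is two-valued, so its σ-algebra is generated by one event and the product formula
from the exchangeability of the clients suffices. -/
lemma IndepCycles.indepFun_participates_duration (hZ : IndepCycles P lam mu Z) (hlam : 0 < lam)
    (hmu : 0 < mu) (hk0 : 0 < k) (hk : k ≤ m) (hm : m ≤ ℓ) (s : Fin e) (i : Fin ℓ) (n : ℕ) :
    IndepFun (participatesRV m k Z s i n) (durationRV m k c Z s n) P := by
  have hX := hZ.measurable_durationRV (m := m) (k := k) (c := c) s n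
  have hI := hZ.measurable_participatesRV (m := m) (k := k) s i n (measurableSet_singleton 1)
  have hind : Indep (MeasurableSpace.generateFrom {participatesRV m k Z s i n ⁻¹' {1}})
      (MeasurableSpace.comap (durationRV m k c Z s n) inferInstance) P := by
    refine IndepSets.indep (MeasurableSpace.generateFrom_le (by simpa using hI)) hX.comap_le
      (IsPiSystem.singleton _) (@MeasurableSpace.isPiSystem_measurableSet Ω
        (MeasurableSpace.comap (durationRV m k c Z s n) inferInstance)) rfl
      (@MeasurableSpace.generateFrom_measurableSet Ω
        (MeasurableSpace.comap (durationRV m k c Z s n) inferInstance)).symm ?_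
    rw [IndepSets_iff]
    rintro t₁ t₂ rfl ⟨t, ht, rfl⟩
    rw [hZ.measure_participates_inter hlam hmu hk0 hk hm s i n ht,
      hZ.measure_participates hlam hmu hk0 hk hm, ← hZ.map_durationRV s n, Measure.map_apply hX ht]
  classical
  rw [IndepFun_iff_Indep]
  refine indep_of_indep_of_le_left hind (Measurable.comap_le ?_)
  have : participatesRV m k Z s i n
      = fun ω => if ω ∈ participatesRV m k Z s i n ⁻¹' {1} then 1 else 0 := by
    ext ω
    simp [participatesRV]
  have h : Measurable[MeasurableSpace.generateFrom {participatesRV m k Z s i n ⁻¹' {1}}]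
      fun ω => if ω ∈ participatesRV m k Z s i n ⁻¹' {1} then 1 else 0 :=
    Measurable.ite (MeasurableSpace.measurableSet_generateFrom rfl) measurable_const
      measurable_const
  rwa [← this] at h

/-- Both are sums over the same cycles. The increments are independent of each other and jointly of
the past, so regrouping preserves independence. Hence conditioning on the count does not bias the
elapsed time. -/
lemma IndepCycles.indepFun_participations_start (hZ : IndepCycles P lam mu Z) (hlam : 0 < lam)
    (hmu : 0 < mu) (hk0 : 0 < k) (hk : k ≤ m) (hm : m ≤ ℓ) (s : Fin e) (i : Fin ℓ) (n : ℕ) :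
    IndepFun (participationsRV m k Z s i n) (startRV m k c Z s n) P := by
  induction n with
  | zero =>
    have : startRV m k c Z s 0 = fun _ => 0 := funext fun ω => startTime_zero s
    rw [this]
    exact indepFun_const_right _ _
  | succ n ih =>
    have h := IndepFun.prodMk_comm (hZ.measurable_participationsRV s i n)
      (hZ.measurable_startRV s n) (hZ.measurable_participatesRV s i n)
      (hZ.measurable_durationRV s n) ih
      (hZ.indepFun_participates_duration (c := c) hlam hmu hk0 hk hm s i n)
      ((hZ.indepFun_past s i n).comp measurable_id
        ((measurable_ite_mem_aggregated m k i).prodMk (measurable_cycleDuration m k c)))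
    have h2 := h.comp (φ := fun q : ℕ × ℕ => q.1 + q.2) (ψ := fun q : ℝ × ℝ => q.1 + q.2)
      (by fun_prop) (by fun_prop)
    convert h2 using 1
    · exact funext (participationsRV_succ s i n)
    · exact funext (startRV_succ s n)

/-- The number of earlier participations of a client is independent of the timing of the current
cycle relative to the cycles of another server. -/
lemma IndepCycles.measure_participations_inter_crossing (hZ : IndepCycles P lam mu Z)
    (hlam : 0 < lam) (hmu : 0 < mu) (hk0 : 0 < k) (hk : k ≤ m) (hm : m ≤ ℓ) {s s' : Fin e}
    (hs : s' ≠ s) (i : Fin ℓ) (j g r : ℕ) :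
    P {ω | participationsRV m k Z s i g ω = j ∧ startRV m k c Z s g ω < startRV m k c Z s' (r + 1) ω
        ∧ startRV m k c Z s' (r + 1) ω ≤ startRV m k c Z s (g + 1) ω}
      = P (participationsRV m k Z s i g ⁻¹' {j}) *
        ∫⁻ t, ∫⁻ x, Renewal.walkLaw (durationLaw ℓ m k lam mu c) (r + 1) (Set.Ioc t (t + x))
          ∂(durationLaw ℓ m k lam mu c) ∂(Renewal.walkLaw (durationLaw ℓ m k lam mu c) g) := by
  have := isProbabilityMeasure_durationLaw (ℓ := ℓ) (m := m) (k := k) (c := c) hlam hmu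
  have hN := hZ.measurable_participationsRV (m := m) (k := k) s i g
  have hS := hZ.measurable_startRV (m := m) (k := k) (c := c) s g
  have hY := hZ.measurable_startRV (m := m) (k := k) (c := c) s' (r + 1)
  have hX := hZ.measurable_durationRV (m := m) (k := k) (c := c) s g
  have hXY : IndepFun (durationRV m k c Z s g) (startRV m k c Z s' (r + 1)) P :=
    hZ.indepFun (T := {x | x.1 = s}) (disjoint_servers hs)
      ((measurable_cycleDuration m k c).comp (measurable_cycleSigma rfl))
      (measurable_startRV_cycleSigma fun _ _ => rfl)
  have hpast : IndepFun (fun ω => (participationsRV m k Z s i g ω, startRV m k c Z s g ω))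
      (fun ω => (durationRV m k c Z s g ω, startRV m k c Z s' (r + 1) ω)) P := by
    refine hZ.indepFun (T := {x | x.1 = s ∧ x.2 < g}) (T' := {x | x.1 = s' ∨ x = (s, g)}) ?_
      ((measurable_participationsRV_cycleSigma (T := {x | x.1 = s ∧ x.2 < g})
        fun _ hq => ⟨rfl, hq⟩).prodMk
      (measurable_startRV_cycleSigma (T := {x | x.1 = s ∧ x.2 < g}) fun _ hq => ⟨rfl, hq⟩))
      (((measurable_cycleDuration m k c).comp
        (measurable_cycleSigma (T := {x | x.1 = s' ∨ x = (s, g)}) (Or.inr rfl))).prodMk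
      (measurable_startRV_cycleSigma (T := {x | x.1 = s' ∨ x = (s, g)}) fun _ hq => Or.inl rfl))
    refine Set.disjoint_left.2 fun x hx hx' => ?_
    rcases hx' with h | h
    · exact hs (h.symm.trans hx.1)
    · exact lt_irrefl g (by simpa [h] using hx.2)
  -- Regrouping with a trivial third variable detaches the count from all three times at once.
  have hind : IndepFun (participationsRV m k Z s i g) (fun ω => (startRV m k c Z s g ω,
      (durationRV m k c Z s g ω, startRV m k c Z s' (r + 1) ω))) P :=
    (IndepFun.prodMk_comm hN hS (C := fun _ => ()) measurable_const (hX.prodMk hY)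
      (hZ.indepFun_participations_start hlam hmu hk0 hk hm s i g) (indepFun_const_left _ _)
      (hpast.comp measurable_id (measurable_const.prodMk measurable_id))).comp
      measurable_fst measurable_id
  have hlaw : P.map (fun ω => (startRV m k c Z s g ω,
      (durationRV m k c Z s g ω, startRV m k c Z s' (r + 1) ω)))
      = (Renewal.walkLaw (durationLaw ℓ m k lam mu c) g).prod ((durationLaw ℓ m k lam mu c).prod
        (Renewal.walkLaw (durationLaw ℓ m k lam mu c) (r + 1))) := by
    rw [(indepFun_iff_map_prod_eq_prod_map_map hS.aemeasurable (hX.prodMk hY).aemeasurable).1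
      (hpast.comp measurable_snd measurable_id),
      (indepFun_iff_map_prod_eq_prod_map_map hX.aemeasurable hY.aemeasurable).1 hXY,
      hZ.map_startRV hlam hmu, hZ.map_startRV hlam hmu, hZ.map_durationRV]
  have hV : MeasurableSet {q : ℝ × (ℝ × ℝ) | q.1 < q.2.2 ∧ q.2.2 ≤ q.1 + q.2.1} :=
    (measurableSet_lt measurable_fst measurable_snd.snd).inter
      (measurableSet_le measurable_snd.snd (measurable_fst.add measurable_snd.fst))
  have hset : {ω | participationsRV m k Z s i g ω = j
        ∧ startRV m k c Z s g ω < startRV m k c Z s' (r + 1) ω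
        ∧ startRV m k c Z s' (r + 1) ω ≤ startRV m k c Z s (g + 1) ω}
      = participationsRV m k Z s i g ⁻¹' {j} ∩ (fun ω => (startRV m k c Z s g ω,
      (durationRV m k c Z s g ω, startRV m k c Z s' (r + 1) ω))) ⁻¹'
        {q : ℝ × (ℝ × ℝ) | q.1 < q.2.2 ∧ q.2.2 ≤ q.1 + q.2.1} := by
    ext ω
    simp only [startRV_succ s g]
    rfl
  rw [hset, hind.measure_inter_preimage_eq_mul _ _ (measurableSet_singleton j) hV,
    ← Measure.map_apply (hS.prodMk (hX.prodMk hY)) hV, hlaw, Measure.prod_apply hV]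
  congr 1
  refine lintegral_congr fun t => ?_
  rw [Measure.prod_apply (measurable_prodMk_left hV)]
  rfl

end Joint

/-! ### Mean number of completions between participations -/

section Expectation

lemma lintegral_ite_one {Ω : Type*} [MeasurableSpace Ω] {P : Measure Ω} {p : Ω → Prop}
    [DecidablePred p]
    (hp : MeasurableSet {ω | p ω}) : ∫⁻ ω, (if p ω then 1 else 0) ∂P = P {ω | p ω} := by
  classical
  rw [← lintegral_indicator_one hp]
  refine lintegral_congr fun ω => ?_
  simp only [Set.indicator_apply, Set.mem_ofPred_eq, Pi.one_apply]

variable {e ℓ : ℕ} {Ω : Type*} {Z : Fin e → ℕ → Ω → (Fin ℓ → ℝ) × (Fin ℓ → ℝ)} {m k : ℕ} {c : ℝ}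

lemma participationsRV_mono (s : Fin e) (i : Fin ℓ) (ω : Ω) :
    Monotone fun n => participationsRV m k Z s i n ω :=
  Nat.count_monotone fun r => i ∈ aggregated m k (Z s r ω).1 (Z s r ω).2

lemma participationsRV_le (s : Fin e) (i : Fin ℓ) (n : ℕ) (ω : Ω) :
    participationsRV m k Z s i n ω ≤ n :=
  Nat.count_le (p := fun r => i ∈ aggregated m k (Z s r ω).1 (Z s r ω).2)

lemma participationsRV_succ' (s : Fin e) (i : Fin ℓ) (n : ℕ) (ω : Ω) :
    participationsRV m k Z s i (n + 1) ω
      = participationsRV m k Z s i n ω + participatesRV m k Z s i n ω :=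
  participationsRV_succ s i n ω

/-- `completionsBetween` as a random variable. -/
noncomputable def completionsRV (m k : ℕ) (c : ℝ)
    (Z : Fin e → ℕ → Ω → (Fin ℓ → ℝ) × (Fin ℓ → ℝ)) (s : Fin e) (i : Fin ℓ) (j : ℕ) (ω : Ω) :
    ℝ≥0∞ :=
  completionsBetween m k c (fun s r => (Z s r ω).1) (fun s r => (Z s r ω).2) s i j

open Classical in
/-- The contribution of one cycle of one server to `completionsRV`. -/
noncomputable def completionsTerm (m k : ℕ) (c : ℝ)
    (Z : Fin e → ℕ → Ω → (Fin ℓ → ℝ) × (Fin ℓ → ℝ)) (s : Fin e) (i : Fin ℓ) (j : ℕ) (s' : Fin e)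
    (r : ℕ) (ω : Ω) : ℝ≥0∞ :=
  if s' = s then
    if participationsRV m k Z s i r ω = j ∧ i ∉ aggregated m k (Z s r ω).1 (Z s r ω).2
      then 1 else 0
  else ∑' g, if participationsRV m k Z s i g ω = j
    ∧ startRV m k c Z s g ω < startRV m k c Z s' (r + 1) ω
    ∧ startRV m k c Z s' (r + 1) ω ≤ startRV m k c Z s (g + 1) ω then 1 else 0

lemma completionsRV_eq (s : Fin e) (i : Fin ℓ) (j : ℕ) : completionsRV m k c Z s i j
    = fun ω => ∑' x : Fin e × ℕ, completionsTerm m k c Z s i j x.1 x.2 ω := rfl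

open Classical in
lemma completionsTerm_self (s : Fin e) (i : Fin ℓ) (j r : ℕ) :
    completionsTerm m k c Z s i j s r = fun ω => if participationsRV m k Z s i r ω = j
      ∧ i ∉ aggregated m k (Z s r ω).1 (Z s r ω).2 then 1 else 0 :=
  funext fun _ => if_pos rfl

open Classical in
lemma completionsTerm_of_ne {s s' : Fin e} (hs : s' ≠ s) (i : Fin ℓ) (j r : ℕ) :
    completionsTerm m k c Z s i j s' r = fun ω => ∑' g, if participationsRV m k Z s i g ω = j
      ∧ startRV m k c Z s g ω < startRV m k c Z s' (r + 1) ω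
      ∧ startRV m k c Z s' (r + 1) ω ≤ startRV m k c Z s (g + 1) ω then 1 else 0 :=
  funext fun _ => if_neg hs

variable [MeasurableSpace Ω] {P : Measure Ω} {lam mu : ℝ}

lemma measure_participations_eq_zero (s : Fin e) (i : Fin ℓ) {j n : ℕ} (h : n < j) :
    P (participationsRV m k Z s i n ⁻¹' {j}) = 0 := by
  have : participationsRV m k Z s i n ⁻¹' {j} = ∅ := by
    ext ω
    have := participationsRV_le (m := m) (k := k) (Z := Z) s i n ω
    simp only [Set.mem_preimage, Set.mem_singleton_iff, Set.mem_empty_iff_false, iff_false]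
    omega
  rw [this, measure_empty]

lemma IndepCycles.measurableSet_own (hZ : IndepCycles P lam mu Z) (s : Fin e) (i : Fin ℓ)
    (j n : ℕ) : MeasurableSet {ω | participationsRV m k Z s i n ω = j
      ∧ i ∉ aggregated m k (Z s n ω).1 (Z s n ω).2} :=
  (hZ.measurable_participationsRV s i n (measurableSet_singleton j)).inter
    (hZ.measurable s n (measurableSet_mem_aggregated m k i)).compl

lemma IndepCycles.measurableSet_crossing (hZ : IndepCycles P lam mu Z) (s s' : Fin e) (i : Fin ℓ)
    (j g r : ℕ) : MeasurableSet {ω | participationsRV m k Z s i g ω = j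
      ∧ startRV m k c Z s g ω < startRV m k c Z s' (r + 1) ω
      ∧ startRV m k c Z s' (r + 1) ω ≤ startRV m k c Z s (g + 1) ω} :=
  (hZ.measurable_participationsRV s i g (measurableSet_singleton j)).inter
    ((measurableSet_lt (hZ.measurable_startRV s g) (hZ.measurable_startRV s' (r + 1))).inter
      (measurableSet_le (hZ.measurable_startRV s' (r + 1)) (hZ.measurable_startRV s (g + 1))))

lemma IndepCycles.measurable_completionsTerm (hZ : IndepCycles P lam mu Z) (s : Fin e)
    (i : Fin ℓ) (j : ℕ) (s' : Fin e) (r : ℕ) :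
    Measurable (completionsTerm m k c Z s i j s' r) := by
  classical
  by_cases hs : s' = s
  · subst hs
    rw [completionsTerm_self]
    exact Measurable.ite (hZ.measurableSet_own _ i j r) measurable_const measurable_const
  · rw [completionsTerm_of_ne hs]
    exact Measurable.tsum fun g => Measurable.ite (hZ.measurableSet_crossing s s' i j g r)
      measurable_const measurable_const

lemma IndepCycles.measurable_completionsRV (hZ : IndepCycles P lam mu Z) (s : Fin e) (i : Fin ℓ)
    (j : ℕ) : Measurable (completionsRV m k c Z s i j) := by
  rw [completionsRV_eq]
  exact Measurable.tsum fun x => hZ.measurable_completionsTerm s i j x.1 x.2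

lemma IndepCycles.indepFun_participations (hZ : IndepCycles P lam mu Z) (s : Fin e)
    (i : Fin ℓ) (n : ℕ) :
    IndepFun (participationsRV m k Z s i n) (participatesRV m k Z s i n) P :=
  (hZ.indepFun_past (c := 0) s i n).comp measurable_fst (measurable_ite_mem_aggregated m k i)

lemma IndepCycles.measure_participations_inter_participates (hZ : IndepCycles P lam mu Z)
    (hlam : 0 < lam) (hmu : 0 < mu) (hk0 : 0 < k) (hk : k ≤ m) (hm : m ≤ ℓ) (s : Fin e)
    (i : Fin ℓ) (j n : ℕ) :
    P (participationsRV m k Z s i n ⁻¹' {j} ∩ participatesRV m k Z s i n ⁻¹' {1})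
      = P (participationsRV m k Z s i n ⁻¹' {j}) * ((k : ℝ≥0∞) / ℓ) := by
  rw [(hZ.indepFun_participations s i n).measure_inter_preimage_eq_mul _ _
    (measurableSet_singleton j) (measurableSet_singleton 1),
    hZ.measure_participates hlam hmu hk0 hk hm]

variable [IsProbabilityMeasure P]

lemma IndepCycles.measure_participates_zero (hZ : IndepCycles P lam mu Z) (hlam : 0 < lam)
    (hmu : 0 < mu) (hk0 : 0 < k) (hk : k ≤ m) (hm : m ≤ ℓ) (s : Fin e) (i : Fin ℓ) (n : ℕ) :
    P (participatesRV m k Z s i n ⁻¹' {0}) = 1 - (k : ℝ≥0∞) / ℓ := by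
  rw [← hZ.measure_participates hlam hmu hk0 hk hm s i n,
    ← prob_compl_eq_one_sub (hZ.measurable_participatesRV s i n (measurableSet_singleton 1))]
  congr 1
  ext ω
  simp [participatesRV]

/-- The mean number of cycles during which a client has participated exactly `j` times. -/
lemma IndepCycles.tsum_measure_participations_le (hZ : IndepCycles P lam mu Z) (hlam : 0 < lam)
    (hmu : 0 < mu) (hk0 : 0 < k) (hk : k ≤ m) (hm : m ≤ ℓ) (s : Fin e) (i : Fin ℓ) (j : ℕ) :
    ∑' n, P (participationsRV m k Z s i n ⁻¹' {j}) ≤ (ℓ : ℝ≥0∞) / k := by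
  -- Participation `j + 1` takes place in at most one cycle. The disjoint events have total
  -- probability at most `1`, and the `n`-th one has probability `P(N_n = j) * (k / ℓ)`.
  have hd : Pairwise (Function.onFun Disjoint fun n =>
      participationsRV m k Z s i n ⁻¹' {j} ∩ participatesRV m k Z s i n ⁻¹' {1}) := by
    refine (pairwise_disjoint_on _).2 fun n n' hn => Set.disjoint_left.2 fun ω h h' => ?_
    have h1 : participationsRV m k Z s i n ω = j := h.1
    have h2 : participatesRV m k Z s i n ω = 1 := h.2
    have h3 : participationsRV m k Z s i n' ω = j := h'.1
    have h4 := participationsRV_mono (m := m) (k := k) (Z := Z) s i ω (Nat.succ_le_of_lt hn)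
    simp only [Nat.succ_eq_add_one, participationsRV_succ' s i n ω] at h4
    omega
  have hsum : (∑' n, P (participationsRV m k Z s i n ⁻¹' {j})) * ((k : ℝ≥0∞) / ℓ) ≤ 1 := by
    rw [← ENNReal.tsum_mul_right]
    simp_rw [← hZ.measure_participations_inter_participates hlam hmu hk0 hk hm s i j]
    rw [← measure_iUnion hd fun n => (hZ.measurable_participationsRV s i n
      (measurableSet_singleton j)).inter (hZ.measurable_participatesRV s i n
        (measurableSet_singleton 1))]
    exact prob_le_one
  have hk' : (k : ℝ≥0∞) ≠ 0 := by exact_mod_cast hk0.ne'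
  have hℓ' : (ℓ : ℝ≥0∞) ≠ 0 := by exact_mod_cast (hk0.trans_le (hk.trans hm)).ne'
  have := (ENNReal.le_div_iff_mul_le (Or.inl (ENNReal.div_ne_zero.2
    ⟨hk', ENNReal.natCast_ne_top ℓ⟩)) (Or.inl (ENNReal.div_ne_top (ENNReal.natCast_ne_top k) hℓ'))).2
    hsum
  rwa [one_div, ENNReal.inv_div (Or.inl (ENNReal.natCast_ne_top ℓ)) (Or.inl hℓ')] at this

/-- The mean number of cycles completed between two consecutive participations of a client. -/
lemma IndepCycles.lintegral_completionsRV_le (hZ : IndepCycles P lam mu Z) (hlam : 0 < lam)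
    (hmu : 0 < mu) (hk0 : 0 < k) (hk : k ≤ m) (hm : m ≤ ℓ) (s : Fin e) (i : Fin ℓ) (j : ℕ)
    {B : ℝ≥0∞} (hB : ∀ g, j ≤ g → Renewal.crossings (durationLaw ℓ m k lam mu c) g ≤ B) :
    ∫⁻ ω, completionsRV m k c Z s i j ω ∂P
      ≤ (ℓ : ℝ≥0∞) / k * (1 - (k : ℝ≥0∞) / ℓ) + (e - 1 : ℕ) * ((ℓ : ℝ≥0∞) / k * B) := by
  classical
  have hν := hZ.tsum_measure_participations_le hlam hmu hk0 hk hm s i j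
  simp only [completionsRV_eq]
  rw [lintegral_tsum (f := fun x : Fin e × ℕ => completionsTerm m k c Z s i j x.1 x.2)
    fun x => (hZ.measurable_completionsTerm s i j x.1 x.2).aemeasurable,
    ENNReal.tsum_prod (f := fun s' r => ∫⁻ ω, completionsTerm m k c Z s i j s' r ω ∂P), tsum_fintype,
    ← Finset.add_sum_erase _ _ (Finset.mem_univ s)]
  refine add_le_add ?_ ((Finset.sum_le_card_nsmul _ _ ((ℓ : ℝ≥0∞) / k * B) ?_).trans_eq ?_)
  · simp only [completionsTerm_self]
    have h : ∀ r, ∫⁻ ω, (if participationsRV m k Z s i r ω = j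
        ∧ i ∉ aggregated m k (Z s r ω).1 (Z s r ω).2 then 1 else 0) ∂P
        = P (participationsRV m k Z s i r ⁻¹' {j}) * (1 - (k : ℝ≥0∞) / ℓ) := fun r => by
      rw [lintegral_ite_one (hZ.measurableSet_own _ i j r),
        ← hZ.measure_participates_zero hlam hmu hk0 hk hm s i r,
        ← (hZ.indepFun_participations s i r).measure_inter_preimage_eq_mul _ _
          (measurableSet_singleton j) (measurableSet_singleton 0)]
      congr 1
      ext ω
      simp [participatesRV]
    simp_rw [h, ENNReal.tsum_mul_right]
    gcongr
  · intro s' hs'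
    have hs : s' ≠ s := Finset.ne_of_mem_erase hs'
    simp only [completionsTerm_of_ne hs]
    have h : ∀ r, ∫⁻ ω, ∑' g, (if participationsRV m k Z s i g ω = j
        ∧ startRV m k c Z s g ω < startRV m k c Z s' (r + 1) ω
        ∧ startRV m k c Z s' (r + 1) ω ≤ startRV m k c Z s (g + 1) ω then 1 else 0) ∂P
        = ∑' g, P (participationsRV m k Z s i g ⁻¹' {j}) *
        ∫⁻ t, ∫⁻ x, Renewal.walkLaw (durationLaw ℓ m k lam mu c) (r + 1) (Set.Ioc t (t + x))
          ∂(durationLaw ℓ m k lam mu c) ∂(Renewal.walkLaw (durationLaw ℓ m k lam mu c) g) :=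
      fun r => by
      rw [lintegral_tsum fun g => (Measurable.ite (hZ.measurableSet_crossing s s' i j g r)
        measurable_const measurable_const).aemeasurable]
      refine tsum_congr fun g => ?_
      rw [lintegral_ite_one (hZ.measurableSet_crossing s s' i j g r),
        hZ.measure_participations_inter_crossing hlam hmu hk0 hk hm hs]
    simp_rw [h]
    have := isProbabilityMeasure_durationLaw (ℓ := ℓ) (m := m) (k := k) (c := c) hlam hmu
    -- Summing first over the foreign cycles `r` produces `crossings g`. The terms with `g < j`
    -- vanish because the count is at most `g`, so late participations only see late cycles.
    rw [ENNReal.tsum_comm]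
    simp_rw [ENNReal.tsum_mul_left]
    refine le_trans (ENNReal.tsum_le_tsum (g := fun g =>
      P (participationsRV m k Z s i g ⁻¹' {j}) * B) fun g => ?_) ?_
    · rcases lt_or_ge g j with hg | hg
      · simp [measure_participations_eq_zero (P := P) s i hg]
      · refine mul_le_mul_right ((Renewal.crossings_eq_tsum g).ge.trans (hB g hg)) _
    · rw [ENNReal.tsum_mul_right]
      gcongr
  · simp

end Expectation

/-! ### Almost sure regularity and Markov's inequality -/

section Staleness

variable {e ℓ : ℕ} {Ω : Type*} {Z : Fin e → ℕ → Ω → (Fin ℓ → ℝ) × (Fin ℓ → ℝ)} {m k : ℕ} {c : ℝ}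
  [MeasurableSpace Ω] {P : Measure Ω} {lam mu : ℝ}

lemma IndepCycles.ae_pos_duration (hZ : IndepCycles P lam mu Z) (hlam : 0 < lam) (hmu : 0 < mu)
    (hc : 0 ≤ c) (hk0 : 0 < k) (hk : k ≤ m) (hm : m ≤ ℓ) :
    ∀ᵐ ω ∂P, ∀ s r, 0 < cycleDuration m k c (Z s r ω).1 (Z s r ω).2 := by
  refine ae_all_iff.2 fun s => ae_all_iff.2 fun r => ?_
  have h := ae_pos_cycleDuration (ℓ := ℓ) hlam hmu hc hk0 hk hm
  rw [← hZ.law s r] at h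
  exact ae_of_ae_map (hZ.measurable s r).aemeasurable h

variable [IsProbabilityMeasure P]

/-- Almost surely, only finitely many cycles are completed in bounded time. -/
lemma IndepCycles.ae_finite_completed (hZ : IndepCycles P lam mu Z) (hlam : 0 < lam) (hmu : 0 < mu)
    (hc : 0 ≤ c) (hk0 : 0 < k) (hk : k ≤ m) (hm : m ≤ ℓ) :
    ∀ᵐ ω ∂P, ∀ (s : Fin e) (t : ℝ), {r | startRV m k c Z s (r + 1) ω ≤ t}.Finite := by
  have := isProbabilityMeasure_durationLaw (ℓ := ℓ) (m := m) (k := k) (c := c) hlam hmu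
  have hF := ae_pos_durationLaw (ℓ := ℓ) hlam hmu hc hk0 hk hm
  have h : ∀ᵐ ω ∂P, ∀ (s : Fin e) (n : ℕ), {r | startRV m k c Z s (r + 1) ω ≤ n}.Finite := by
    refine ae_all_iff.2 fun s => ae_all_iff.2 fun n => ?_
    -- Borel–Cantelli: the sum of the probabilities is at most the renewal function at `n`, finite
    -- by Wald's inequality.
    refine ae_finite_setOfPred_mem (s := fun r => startRV m k c Z s (r + 1) ⁻¹' Set.Iic (n : ℝ)) ?_
    have h1 : ∀ r, P (startRV m k c Z s (r + 1) ⁻¹' Set.Iic (n : ℝ))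
        = Renewal.walkLaw (durationLaw ℓ m k lam mu c) (r + 1) (Set.Iic (n : ℝ)) := fun r => by
      rw [← Measure.map_apply (hZ.measurable_startRV s (r + 1)) measurableSet_Iic,
        hZ.map_startRV hlam hmu]
    simp_rw [h1]
    refine ne_top_of_le_ne_top (b := Renewal.renewalFun (durationLaw ℓ m k lam mu c) n) ?_
      (ENNReal.tsum_comp_le_tsum_of_injective (add_left_injective 1) _)
    exact ne_top_of_le_ne_top (ENNReal.div_ne_top ENNReal.ofReal_ne_top
      (Renewal.truncMean_ne_zero hF one_pos)) (Renewal.renewalFun_le_div hF one_pos n.cast_nonneg)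
  filter_upwards [h] with ω hω s t
  obtain ⟨n, hn⟩ := exists_nat_ge t
  exact (hω s n).subset fun r hr => le_trans hr hn

/-- Almost surely, a client participates infinitely often. -/
lemma IndepCycles.ae_infinite_aggregated (hZ : IndepCycles P lam mu Z) (hlam : 0 < lam)
    (hmu : 0 < mu) (hk0 : 0 < k) (hk : k ≤ m) (hm : m ≤ ℓ) (s : Fin e) (i : Fin ℓ) :
    ∀ᵐ ω ∂P, {r | i ∈ aggregated m k (Z s r ω).1 (Z s r ω).2}.Infinite := by
  have h : ∀ᵐ ω ∂P, ∀ j, {n | participationsRV m k Z s i n ω = j}.Finite := by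
    refine ae_all_iff.2 fun j => ?_
    refine ae_finite_setOfPred_mem (s := fun n => participationsRV m k Z s i n ⁻¹' {j}) ?_
    exact ne_top_of_le_ne_top (ENNReal.div_ne_top (ENNReal.natCast_ne_top ℓ)
      (by exact_mod_cast hk0.ne')) (hZ.tsum_measure_participations_le hlam hmu hk0 hk hm s i j)
  -- With finitely many participations the count would be bounded, and finitely many finite level
  -- sets would cover `ℕ`.
  filter_upwards [h] with ω hω hfin
  refine Set.infinite_univ (α := ℕ) (((Set.finite_Iic hfin.toFinset.card).biUnion
    fun j _ => hω j).subset fun n _ => ?_)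
  refine Set.mem_biUnion (x := participationsRV m k Z s i n ω) ?_ rfl
  rw [Set.mem_Iic, participationsRV, participations, Nat.count_eq_card_filter_range]
  exact Finset.card_le_card fun r hr => by simpa using (Finset.mem_filter.1 hr).2

/-- Staleness as a random variable of the cycles. -/
noncomputable def stalenessRV (m k : ℕ) (c : ℝ) (Z : Fin e → ℕ → Ω → (Fin ℓ → ℝ) × (Fin ℓ → ℝ))
    (s : Fin e) (i : Fin ℓ) (j : ℕ) (ω : Ω) : ℤ :=
  staleness m k c (fun s r => (Z s r ω).1) (fun s r => (Z s r ω).2) s i j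

lemma IndepCycles.ae_stalenessRV_le (hZ : IndepCycles P lam mu Z) (hlam : 0 < lam) (hmu : 0 < mu)
    (hc : 0 ≤ c) (hk0 : 0 < k) (hk : k ≤ m) (hm : m ≤ ℓ) (s : Fin e) (i : Fin ℓ) (j : ℕ) :
    ∀ᵐ ω ∂P, ((stalenessRV m k c Z s i (j + 1) ω).toNat : ℝ≥0∞) ≤ completionsRV m k c Z s i j ω := by
  filter_upwards [hZ.ae_pos_duration hlam hmu hc hk0 hk hm,
    hZ.ae_finite_completed hlam hmu hc hk0 hk hm,
    hZ.ae_infinite_aggregated hlam hmu hk0 hk hm s i] with ω h1 h2 h3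
  exact staleness_le_completionsBetween h1 h2 h3 j

/-- An integer exceeding `M` is at least `⌊M⌋₊ + 1`, so Markov's inequality is used at that level.
Being strictly above `M`, it leaves room even when `M` equals the explicit bound. -/
lemma IndepCycles.le_measureReal_stalenessRV_le (hZ : IndepCycles P lam mu Z) (hlam : 0 < lam)
    (hmu : 0 < mu) (hc : 0 ≤ c) (hk0 : 0 < k) (hk : k ≤ m) (hm : m ≤ ℓ) (s : Fin e) (i : Fin ℓ)
    (j : ℕ) {B ε M : ℝ} (hB0 : 0 ≤ B) (hε : 0 < ε) (hM : 0 ≤ M)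
    (hB : ∀ g, j ≤ g → Renewal.crossings (durationLaw ℓ m k lam mu c) g ≤ ENNReal.ofReal B)
    (h : (ℓ : ℝ) / k - 1 + ((e : ℝ) - 1) * (ℓ / k * B) ≤ ε * (⌊M⌋₊ + 1)) :
    1 - ε ≤ P.real {ω | (stalenessRV m k c Z s i (j + 1) ω : ℝ) ≤ M} := by
  have hkR : (0 : ℝ) < k := by exact_mod_cast hk0
  have hℓR : (0 : ℝ) < ℓ := by exact_mod_cast hk0.trans_le (hk.trans hm)
  have hkℓ : (k : ℝ) / ℓ ≤ 1 := (div_le_one hℓR).2 (by exact_mod_cast hk.trans hm)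
  have he : 1 ≤ e := s.pos
  have hmean : ∫⁻ ω, completionsRV m k c Z s i j ω ∂P ≤ ENNReal.ofReal (ε * (⌊M⌋₊ + 1)) := by
    refine (hZ.lintegral_completionsRV_le hlam hmu hk0 hk hm s i j hB).trans
      (le_trans (le_of_eq ?_) (ENNReal.ofReal_le_ofReal h))
    have e1 : (ℓ : ℝ≥0∞) / k = ENNReal.ofReal (ℓ / k) := by
      rw [ENNReal.ofReal_div_of_pos hkR, ENNReal.ofReal_natCast, ENNReal.ofReal_natCast]
    have e2 : 1 - (k : ℝ≥0∞) / ℓ = ENNReal.ofReal (1 - k / ℓ) := by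
      rw [ENNReal.ofReal_sub _ (by positivity), ENNReal.ofReal_one,
        ENNReal.ofReal_div_of_pos hℓR, ENNReal.ofReal_natCast, ENNReal.ofReal_natCast]
    have e3 : ((e - 1 : ℕ) : ℝ≥0∞) = ENNReal.ofReal ((e : ℝ) - 1) := by
      rw [← ENNReal.ofReal_natCast, Nat.cast_sub he, Nat.cast_one]
    have h3 : (0 : ℝ) ≤ (e : ℝ) - 1 := by
      have : (1 : ℝ) ≤ e := by exact_mod_cast he
      linarith
    rw [e1, e2, e3, ← ENNReal.ofReal_mul (by positivity), ← ENNReal.ofReal_mul (by positivity),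
      ← ENNReal.ofReal_mul h3, ← ENNReal.ofReal_add (mul_nonneg (by positivity) (by linarith))
        (by positivity)]
    congr 2
    field_simp
  -- The bad event is defined through the measurable majorant. The staleness enters only by an
  -- almost sure inclusion, so its own measurability is not needed.
  set V : Set Ω := {ω | ((⌊M⌋₊ + 1 : ℕ) : ℝ≥0∞) ≤ completionsRV m k c Z s i j ω} with hV
  have hVm : MeasurableSet V := measurableSet_le measurable_const (hZ.measurable_completionsRV s i j)
  have hPV : P V ≤ ENNReal.ofReal ε := by
    have h1 := (mul_meas_ge_le_lintegral₀ (hZ.measurable_completionsRV (m := m) (k := k) (c := c)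
      s i j).aemeasurable ((⌊M⌋₊ + 1 : ℕ) : ℝ≥0∞)).trans hmean
    have h2 : ENNReal.ofReal (ε * (⌊M⌋₊ + 1))
        = ((⌊M⌋₊ + 1 : ℕ) : ℝ≥0∞) * ENNReal.ofReal ε := by
      rw [mul_comm, ENNReal.ofReal_mul (by positivity), ← ENNReal.ofReal_natCast]
      push_cast
      rfl
    rw [h2] at h1
    exact (ENNReal.mul_le_mul_iff_right (by simp) (ENNReal.natCast_ne_top _)).1 h1
  have hsub : Vᶜ ≤ᵐ[P] {ω | (stalenessRV m k c Z s i (j + 1) ω : ℝ) ≤ M} := by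
    filter_upwards [hZ.ae_stalenessRV_le hlam hmu hc hk0 hk hm s i j] with ω hω hωV
    have h1 : ((stalenessRV m k c Z s i (j + 1) ω).toNat : ℝ≥0∞) < ((⌊M⌋₊ + 1 : ℕ) : ℝ≥0∞) :=
      hω.trans_lt (not_le.1 hωV)
    have h2 : (stalenessRV m k c Z s i (j + 1) ω).toNat ≤ ⌊M⌋₊ :=
      Nat.lt_succ_iff.1 (by exact_mod_cast h1)
    have h3 : stalenessRV m k c Z s i (j + 1) ω ≤ (⌊M⌋₊ : ℤ) :=
      (Int.self_le_toNat _).trans (by exact_mod_cast h2)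
    calc (stalenessRV m k c Z s i (j + 1) ω : ℝ) ≤ ((⌊M⌋₊ : ℤ) : ℝ) := by exact_mod_cast h3
      _ = (⌊M⌋₊ : ℝ) := by push_cast; rfl
      _ ≤ M := Nat.floor_le hM
  have h1 : P.real Vᶜ ≤ P.real {ω | (stalenessRV m k c Z s i (j + 1) ω : ℝ) ≤ M} :=
    ENNReal.toReal_mono (measure_ne_top _ _) (measure_mono_ae hsub)
  have h2 : P.real V ≤ ε := ENNReal.toReal_le_of_le_ofReal hε.le hPV
  have h3 := probReal_compl_eq_one_sub (μ := P) hVm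
  linarith

end Staleness

/-! ### From independent times to independent cycles -/

section Regroup

/-- Independence means that the joint law is a product, and a product over a sigma type is a product
of products. This groups all times of one cycle into a block. -/
lemma _root_.ProbabilityTheory.iIndepFun.curry {ι Ω : Type*} [MeasurableSpace Ω] {P : Measure Ω}
    {κ : ι → Type*} {𝓧 : (i : ι) → κ i → Type*} [∀ i j, MeasurableSpace (𝓧 i j)]
    {X : (i : ι) → (j : κ i) → Ω → 𝓧 i j} (mX : ∀ i j, Measurable (X i j))
    (h : iIndepFun (fun (p : (i : ι) × κ i) ω => X p.1 p.2 ω) P) :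
    iIndepFun (fun i ω j => X i j ω) P := by
  have := h.isProbabilityMeasure
  have : ∀ i j, IsProbabilityMeasure (P.map (X i j)) :=
    fun i j => Measure.isProbabilityMeasure_map (mX i j).aemeasurable
  have hc : (MeasurableEquiv.piCurry 𝓧) ∘ (fun ω p => X p.1 p.2 ω) = fun ω i j => X i j ω := by
    ext
    simp [Sigma.curry]
  rw [iIndepFun_iff_map_fun_eq_infinitePi_map (by fun_prop), ← hc,
    ← Measure.map_map (by fun_prop) (by fun_prop),
    (iIndepFun_iff_map_fun_eq_infinitePi_map (by fun_prop)).1 h,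
    Measure.infinitePi_map_piCurry (fun i j => P.map (X i j))]
  congrm Measure.infinitePi fun i => ?_
  have hi : iIndepFun (X i) P := h.precomp (g := fun j => (⟨i, j⟩ : (i : ι) × κ i))
    sigma_mk_injective
  rw [(iIndepFun_iff_map_fun_eq_infinitePi_map (by fun_prop)).1 hi]

variable {e ℓ : ℕ} {Ω : Type*} [MeasurableSpace Ω] {P : Measure Ω} [IsProbabilityMeasure P]
  {lam mu : ℝ} {A U : Fin e → ℕ → Fin ℓ → Ω → ℝ}

/-- The availability and uplink times of a cycle, for measurable times. -/
lemma IsTimelyAHFL.indepCycles (h : IsTimelyAHFL P lam mu A U)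
    (hA : ∀ s r i, Measurable (A s r i)) (hU : ∀ s r i, Measurable (U s r i)) :
    IndepCycles P lam mu fun s r ω => ((fun i => A s r i ω), fun i => U s r i ω) := by
  set Y : Fin e × ℕ → Fin ℓ ⊕ Fin ℓ → Ω → ℝ := fun x => Sum.elim (A x.1 x.2) (U x.1 x.2) with hY
  have hYm : ∀ x y, Measurable (Y x y) := fun x y => by
    rcases y with i | i
    exacts [hA x.1 x.2 i, hU x.1 x.2 i]
  have hind : iIndepFun (fun (p : (_ : Fin e × ℕ) × (Fin ℓ ⊕ Fin ℓ)) ω => Y p.1 p.2 ω) P := by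
    have := h.indep.precomp (g := fun p : (_ : Fin e × ℕ) × (Fin ℓ ⊕ Fin ℓ) =>
      Sum.map (fun i => (p.1.1, p.1.2, i)) (fun i => (p.1.1, p.1.2, i)) p.2) (by
        rintro ⟨⟨s, r⟩, i | i⟩ ⟨⟨s', r'⟩, i' | i'⟩ h <;> simp_all)
    convert this using 1
    funext ⟨⟨s, r⟩, i⟩
    rcases i with i | i <;> rfl
  have hcurry := hind.curry hYm
  refine ⟨fun s r => (measurable_pi_lambda _ (hA s r)).prodMk (measurable_pi_lambda _ (hU s r)),
    fun s r => ?_, ?_⟩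
  · have hi : iIndepFun (Y (s, r)) P := hind.precomp
      (g := fun j => (⟨(s, r), j⟩ : (_ : Fin e × ℕ) × (Fin ℓ ⊕ Fin ℓ)))
      fun _ _ hj => by simpa using hj
    have : ∀ y, IsProbabilityMeasure (P.map (Y (s, r) y)) :=
      fun y => Measure.isProbabilityMeasure_map (hYm (s, r) y).aemeasurable
    have hmap : P.map (MeasurableEquiv.sumPiEquivProdPi (fun _ : Fin ℓ ⊕ Fin ℓ => ℝ)
        ∘ fun ω y => Y (s, r) y ω) = cycleLaw ℓ lam mu := by
      rw [← Measure.map_map (MeasurableEquiv.measurable _) (measurable_pi_lambda _ (hYm (s, r))),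
        hi.map_fun_eq_pi_map fun y => (hYm (s, r) y).aemeasurable,
        (measurePreserving_sumPiEquivProdPi fun y => P.map (Y (s, r) y)).map_eq, cycleLaw,
        expVector, expVector]
      simp only [hY, Sum.elim_inl, Sum.elim_inr, (h.law_avail s r _).map_eq,
        (h.law_uplink s r _).map_eq]
    exact hmap
  · exact hcurry.comp (fun _ => MeasurableEquiv.sumPiEquivProdPi fun _ : Fin ℓ ⊕ Fin ℓ => ℝ)
      fun _ => MeasurableEquiv.measurable _

/-- Up to null sets, the system consists of independent cycles. -/
lemma IsTimelyAHFL.exists_indepCycles (h : IsTimelyAHFL P lam mu A U) :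
    ∃ Z : Fin e → ℕ → Ω → (Fin ℓ → ℝ) × (Fin ℓ → ℝ), IndepCycles P lam mu Z ∧
      ∀ᵐ ω ∂P, ∀ s r, Z s r ω = ((fun i => A s r i ω), fun i => U s r i ω) := by
  -- `HasLaw` provides only almost everywhere measurability. Measurable versions of countably many
  -- variables change the system on a null set.
  have hAe : ∀ s r i, A s r i =ᵐ[P] (h.law_avail s r i).aemeasurable.mk (A s r i) :=
    fun s r i => (h.law_avail s r i).aemeasurable.ae_eq_mk
  have hUe : ∀ s r i, U s r i =ᵐ[P] (h.law_uplink s r i).aemeasurable.mk (U s r i) :=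
    fun s r i => (h.law_uplink s r i).aemeasurable.ae_eq_mk
  have h' : IsTimelyAHFL P lam mu (fun s r i => (h.law_avail s r i).aemeasurable.mk (A s r i))
      (fun s r i => (h.law_uplink s r i).aemeasurable.mk (U s r i)) := by
    refine ⟨fun s r i => (h.law_avail s r i).congr (hAe s r i).symm,
      fun s r i => (h.law_uplink s r i).congr (hUe s r i).symm, h.indep.congr ?_⟩
    rintro (x | x)
    exacts [hAe _ _ _, hUe _ _ _]
  refine ⟨_, h'.indepCycles (fun s r i => (h.law_avail s r i).aemeasurable.measurable_mk)
    (fun s r i => (h.law_uplink s r i).aemeasurable.measurable_mk), ?_⟩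
  refine ae_all_iff.2 fun s => ae_all_iff.2 fun r => ?_
  filter_upwards [ae_all_iff.2 (hAe s r), ae_all_iff.2 (hUe s r)] with ω h1 h2
  exact Prod.ext (funext fun i => (h1 i).symm) (funext fun i => (h2 i).symm)

end Regroup

/-! ### Transfer to the original times and rounding estimates -/

section Bounds

variable {e ℓ : ℕ} {Ω : Type*} [MeasurableSpace Ω] {P : Measure Ω} [IsProbabilityMeasure P]
  {lam mu c : ℝ} {A U : Fin e → ℕ → Fin ℓ → Ω → ℝ} {m k : ℕ}

lemma IsTimelyAHFL.le_measureReal_randomStaleness_le (h : IsTimelyAHFL P lam mu A U) (hlam : 0 < lam)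
    (hmu : 0 < mu) (hc : 0 ≤ c) (hk0 : 0 < k) (hk : k ≤ m) (hm : m ≤ ℓ) (s : Fin e) (i : Fin ℓ)
    (j : ℕ) {B ε M : ℝ} (hB0 : 0 ≤ B) (hε : 0 < ε) (hM : 0 ≤ M)
    (hB : ∀ g, j ≤ g → Renewal.crossings (durationLaw ℓ m k lam mu c) g ≤ ENNReal.ofReal B)
    (hb : (ℓ : ℝ) / k - 1 + ((e : ℝ) - 1) * (ℓ / k * B) ≤ ε * (⌊M⌋₊ + 1)) :
    1 - ε ≤ P.real {ω | (randomStaleness m k c A U s i (j + 1) ω : ℝ) ≤ M} := by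
  obtain ⟨Z, hZ, hae⟩ := h.exists_indepCycles
  have h1 := hZ.le_measureReal_stalenessRV_le hlam hmu hc hk0 hk hm s i j hB0 hε hM hB hb
  refine h1.trans_eq (measureReal_congr ?_)
  filter_upwards [hae] with ω hω
  have h2 : stalenessRV m k c Z s i (j + 1) ω = randomStaleness m k c A U s i (j + 1) ω := by
    simp only [stalenessRV, randomStaleness, hω]
  exact congrArg (fun x : ℤ => (x : ℝ) ≤ M) h2

lemma ceil_bounds {α β : ℝ} (hα : α ∈ Set.Ioo (0 : ℝ) 1) (hβ : β ∈ Set.Ioo (0 : ℝ) 1) (hℓ : 0 < ℓ)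
    (hm : m = ⌈β * ℓ⌉₊) (hk : k = ⌈α * m⌉₊) :
    0 < k ∧ k ≤ m ∧ m ≤ ℓ ∧ β * ℓ ≤ m ∧ α * m ≤ k ∧ (m : ℝ) < β * ℓ + 1 ∧ (k : ℝ) < α * m + 1 := by
  have hℓR : (0 : ℝ) < ℓ := by exact_mod_cast hℓ
  have hβℓ : 0 < β * ℓ := mul_pos hβ.1 hℓR
  have hm0 : 0 < m := hm ▸ Nat.ceil_pos.2 hβℓ
  have hmR : (0 : ℝ) < m := by exact_mod_cast hm0
  have hαm : 0 < α * m := mul_pos hα.1 hmR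
  refine ⟨hk ▸ Nat.ceil_pos.2 hαm, hk ▸ Nat.ceil_le.2 ?_, hm ▸ Nat.ceil_le.2 ?_, hm ▸ Nat.le_ceil _,
    hk ▸ Nat.le_ceil _, ?_, ?_⟩
  · nlinarith [hα.2]
  · nlinarith [hβ.2]
  · rw [hm]
    exact Nat.ceil_lt_add_one hβℓ.le
  · rw [hk]
    exact Nat.ceil_lt_add_one hαm.le

lemma div_le_one_div_mul {α β : ℝ} (hα : 0 < α) (hβ : 0 < β) (hk0 : 0 < k) (h1 : β * ℓ ≤ m)
    (h2 : α * m ≤ k) : (ℓ : ℝ) / k ≤ 1 / (α * β) := by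
  have hkR : (0 : ℝ) < k := by exact_mod_cast hk0
  rw [div_le_div_iff₀ hkR (mul_pos hα hβ)]
  nlinarith [mul_le_mul_of_nonneg_left h1 hα.le]

end Bounds

end AHFL

/-! ### The two bounds -/

theorem theorem1 (α β ε : ℝ) (hα : α ∈ Set.Ioo (0 : ℝ) 1) (hβ : β ∈ Set.Ioo (0 : ℝ) 1)
    (hε : ε ∈ Set.Ioo (0 : ℝ) 1) (eMax : ℕ) :
    -- a bound that is uniform in the number `n` of clients
    (∃ M : ℝ, ∀ (n e ℓ m k : ℕ) (lam mu c : ℝ) (Ω : Type*) [MeasurableSpace Ω] (P : Measure Ω)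
        [IsProbabilityMeasure P] (A U : Fin e → ℕ → Fin ℓ → Ω → ℝ),
        e ≤ eMax → n = e * ℓ → m = ⌈β * ℓ⌉₊ → k = ⌈α * m⌉₊ → 0 < lam → 0 < mu → 0 ≤ c →
        AHFL.IsTimelyAHFL P lam mu A U →
        ∀ (s : Fin e) (i : Fin ℓ) (j : ℕ), 1 ≤ j →
          1 - ε ≤ P.real {ω | (AHFL.randomStaleness m k c A U s i j ω : ℝ) ≤ M}) ∧
    -- in steady state an explicit bound suffices
    (∀ (n e ℓ m k : ℕ) (lam mu c : ℝ) (Ω : Type*) [MeasurableSpace Ω] (P : Measure Ω)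
        [IsProbabilityMeasure P] (A U : Fin e → ℕ → Fin ℓ → Ω → ℝ),
        n = e * ℓ → m = ⌈β * ℓ⌉₊ → k = ⌈α * m⌉₊ → 0 < lam → 0 < mu → 0 ≤ c →
        AHFL.IsTimelyAHFL P lam mu A U →
        ∀ (M : ℝ), ((e : ℝ) / (α * β) - 1) / ε ≤ M → ∀ (s : Fin e) (i : Fin ℓ),
          ∀ᶠ j : ℕ in atTop,
            1 - ε ≤ P.real {ω | (AHFL.randomStaleness m k c A U s i j ω : ℝ) ≤ M}) := by
  have hα0 := hα.1
  have hβ0 := hβ.1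
  have hε0 := hε.1
  have hαβ : 0 < α * β := mul_pos hα0 hβ0
  have hα1 : 0 < 1 - α := sub_pos.2 hα.2
  have hβ1 : 0 < 1 - β := sub_pos.2 hβ.2
  constructor
  · set C : ℝ := 2 * (4 / (β * (1 - β)) + 4 / (α * (1 - α)) + 2) with hC
    have hC0 : 0 ≤ C := by positivity
    -- `D` bounds the mean through `ℓ / k ≤ 1 / (α * β)`, `e - 1 ≤ eMax` and `crossings ≤ C`;
    -- Markov's inequality then suggests `M = D / ε`.
    set D : ℝ := 1 / (α * β) + eMax * (1 / (α * β) * C) with hD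
    have hD0 : 0 ≤ D := by positivity
    refine ⟨D / ε, ?_⟩
    intro n e ℓ m k lam mu c Ω _ P _ A U he _ hm hk hlam hmu hc h s i j hj
    obtain ⟨hk0, hkm, hmℓ, h1, h2, h3, h4⟩ := AHFL.ceil_bounds hα hβ i.pos hm hk
    obtain ⟨j, rfl⟩ : ∃ j', j = j' + 1 := ⟨j - 1, by omega⟩
    have hr := AHFL.div_le_one_div_mul hα0 hβ0 hk0 h1 h2
    refine h.le_measureReal_randomStaleness_le hlam hmu hc hk0 hkm hmℓ s i j hC0 hε0
      (div_nonneg hD0 hε0.le)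
      (fun g _ => AHFL.crossings_durationLaw_le hlam hmu hc hα hβ hk0 hkm hmℓ h1 h2 h3 h4 g) ?_
    have hfl : D ≤ ε * (⌊D / ε⌋₊ + 1) := by
      have := (Nat.lt_floor_add_one (D / ε)).le
      rw [div_le_iff₀ hε0] at this
      linarith
    refine le_trans ?_ hfl
    have heR : (e : ℝ) - 1 ≤ eMax := by
      have : (e : ℝ) ≤ eMax := by exact_mod_cast he
      linarith
    have h5 : (ℓ : ℝ) / k * C ≤ 1 / (α * β) * C := mul_le_mul_of_nonneg_right hr hC0
    have h6 : ((e : ℝ) - 1) * (ℓ / k * C) ≤ eMax * (1 / (α * β) * C) :=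
      mul_le_mul heR h5 (by positivity) (by positivity)
    linarith
  · intro n e ℓ m k lam mu c Ω _ P _ A U _ hm hk hlam hmu hc h M hM s i
    obtain ⟨hk0, hkm, hmℓ, h1, h2, h3, h4⟩ := AHFL.ceil_bounds hα hβ i.pos hm hk
    have hr := AHFL.div_le_one_div_mul hα0 hβ0 hk0 h1 h2
    have hkR : (0 : ℝ) < k := by exact_mod_cast hk0
    have hℓR : (0 : ℝ) < ℓ := by exact_mod_cast i.pos
    have he : (1 : ℝ) ≤ e := by exact_mod_cast s.pos
    have hρ0 : 0 < (ℓ : ℝ) / k := div_pos hℓR hkR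
    have hρ1 : (1 : ℝ) ≤ 1 / (α * β) := by
      rw [le_div_iff₀ hαβ]
      nlinarith [hα.2, hβ.2]
    have hee : (e : ℝ) * (ℓ / k) ≤ e / (α * β) := by
      rw [div_eq_mul_one_div (e : ℝ)]
      exact mul_le_mul_of_nonneg_left hr (by positivity)
    have hM0 : 0 ≤ M := le_trans (div_nonneg (by
      rw [div_eq_mul_one_div (e : ℝ)]
      nlinarith) hε0.le) hM
    rw [div_le_iff₀ hε0] at hM
    -- The slack between the Markov level and the limiting mean bound is positive because `⌊M⌋₊ + 1
    -- > M`.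
    set η : ℝ := ε * (⌊M⌋₊ + 1) - (e * (ℓ / k) - 1) with hη
    have hη0 : 0 < η := by
      have := mul_lt_mul_of_pos_left (Nat.lt_floor_add_one M) hε0
      rw [hη]
      linarith
    -- Replacing the limit `1` of the crossings by `1 + δ` raises the mean bound by `(e - 1) * (ℓ /
    -- k) * δ`, which is at most `η`.
    set δ : ℝ := η / (e * (ℓ / k)) with hδ
    have hδ0 : 0 < δ := by positivity
    have := AHFL.isProbabilityMeasure_durationLaw (ℓ := ℓ) (m := m) (k := k) (c := c) hlam hmu
    have hlim := Renewal.limsup_crossings_le_one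
      (F := AHFL.durationLaw ℓ m k lam mu c) (θ := ℓ * lam)
      (AHFL.ae_pos_durationLaw hlam hmu hc hk0 hkm hmℓ) (by positivity)
      (fun t ht => AHFL.map_add_const_durationLaw_le hlam hmu (hk0.trans_le hkm) hmℓ t ht)
      (ne_top_of_le_ne_top ENNReal.ofReal_ne_top
        (AHFL.lintegral_durationLaw_le hlam hmu hc hα.2 hβ.2 hk0 hkm hmℓ h3 h4))
    have hev : ∀ᶠ g in atTop, Renewal.crossings (AHFL.durationLaw ℓ m k lam mu c) g
        ≤ ENNReal.ofReal (1 + δ) := by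
      have : limsup (Renewal.crossings (AHFL.durationLaw ℓ m k lam mu c)) atTop
          < ENNReal.ofReal (1 + δ) :=
        hlim.trans_lt (by rw [← ENNReal.ofReal_one]; exact (ENNReal.ofReal_lt_ofReal_iff (by linarith)).2 (by linarith))
      exact (eventually_lt_of_limsup_lt this).mono fun g hg => hg.le
    obtain ⟨g₀, hg₀⟩ := eventually_atTop.1 hev
    -- Participation `j' + 1` involves only cycles `g ≥ j'`, hence the shift of `g₀` by one.
    filter_upwards [eventually_ge_atTop (g₀ + 1)] with j hj
    obtain ⟨j, rfl⟩ : ∃ j', j = j' + 1 := ⟨j - 1, by omega⟩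
    refine h.le_measureReal_randomStaleness_le hlam hmu hc hk0 hkm hmℓ s i j (B := 1 + δ)
      (by linarith) hε0 hM0 (fun g hg => hg₀ g (by omega)) ?_
    have h5 : e * (ℓ / k) * δ = η := by
      rw [hδ]
      field_simp
    have h6 : 0 ≤ (ℓ : ℝ) / k * δ := by positivity
    nlinarith
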